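/- Let $(M,\omega)$ be a symplectic manifold without boundary (open or closed). Conventions: the Hamiltonian vector field $\operatorname{sgrad}F$ of a smooth function $F$ is defined by $\omega(\operatorname{sgrad}F,\cdot)=-dF$, the Poisson bracket is $\{F,G\}=dF(\operatorname{sgrad}G)$, and $\|F\|=\sup|F|$. For compact subsets $X_0,X_1,Y_0,Y_1$ of a symplectic manifold $N$ put $$pb_4(X_0,X_1,Y_0,Y_1)=\inf\|\{F,G\}\|\in[0,+\infty],$$ where the infimum is over all pairs $F,G\in C^\infty_c(N)$ with $F|_{X_0}\le 0$, $F|_{X_1}\ge 1$, $G|_{Y_0}\le 0$, $G|_{Y_1}\ge 1$ (and is $+\infty$ if there are no such pairs). For $0<R\le\infty$ let $\mathbb A_R=\{(r,\theta)\in T^*S^1=\mathbb R\times S^1:\ |r|<R\}$, with $\theta$ taken mod $1$, and for $X\subset M$ let $$\mathrm{stab}_R X=X\times\{r=0\}\subset (M\times\mathbb A_R,\ \omega+dr\wedge d\theta).$$ **Theorem.** Let $X_0,X_1,Y_0,Y_1\subset M$ be compact sets with $X_0\cap X_1=Y_0\cap Y_1=\emptyset$ such that, for some $R\in(1,+\infty]$,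 $$pb_4(\mathrm{stab}_R X_0,\mathrm{stab}_R X_1,\mathrm{stab}_R Y_0,\mathrm{stab}_R Y_1)=p>0 .$$ Let $G\in C^\infty_c(M\times S^1)$, $S^1=\mathbb R/\mathbb Z$, be a $1$-periodic Hamiltonian, $G_t=G(\cdot,t)$, such that $G_t|_{Y_0}\le 0$ and $G_t|_{Y_1}\ge 1$ for all $t\in S^1$ and $\max G-\min G<R$. Then $G$ generates a Hamiltonian flow $g_t$, $t\in\mathbb R$, that is, $g_0=\mathrm{id}$ and $\frac{d}{dt}g_tx=(\operatorname{sgrad}G_t)(g_tx)$ for all $x\in M$, and there exist a point $x\in M$ and times $t_0,t_1\in\mathbb R$ with $|t_0-t_1|\le 1/p$ such that $g_{t_0}x\in X_0$ and $g_{t_1}x\in X_1$. -/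

import Mathlib

open scoped Manifold ContDiff Topology

noncomputable section

/-- A field of continuous bilinear forms on the tangent spaces of a manifold. A differential
`2`-form is such a field all of whose values are alternating. -/
abbrev BilinField {E : Type*} [NormedAddCommGroup E] [NormedSpace ℝ E]
    {H : Type*} [TopologicalSpace H] (I : ModelWithCorners ℝ E H)
    (M : Type*) [TopologicalSpace M] [ChartedSpace H M] : Type _ :=
  ∀ x : M, TangentSpace I x →L[ℝ] TangentSpace I x →L[ℝ] ℝ

section General

variable {E : Type*} [NormedAddCommGroup E] [NormedSpace ℝ E]
  {H : Type*} [TopologicalSpace H] {I : ModelWithCorners ℝ E H}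
  {M : Type*} [TopologicalSpace M] [ChartedSpace H M]
  {E' : Type*} [NormedAddCommGroup E'] [NormedSpace ℝ E']
  {H' : Type*} [TopologicalSpace H'] {I' : ModelWithCorners ℝ E' H'}
  {N : Type*} [TopologicalSpace N] [ChartedSpace H' N]

/-- `Ω` is a symplectic form: a smooth, alternating, nondegenerate and closed `2`-form.
Closedness is `dΩ(X, Y, Z) = 0` for all smooth vector fields, with `dΩ` written by the invariant
formula. -/
structure IsSymplecticForm [IsManifold I ∞ M] (Ω : BilinField I M) : Prop where
  smooth : ContMDiff I (I.prod 𝓘(ℝ, E →L[ℝ] E →L[ℝ] ℝ)) ∞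
    (fun x ↦ Bundle.TotalSpace.mk' (E →L[ℝ] E →L[ℝ] ℝ)
      (E := fun x : M ↦ TangentSpace I x →L[ℝ] TangentSpace I x →L[ℝ] ℝ) x (Ω x))
  alternating : ∀ (x : M) (v : TangentSpace I x), Ω x v v = 0
  nondegenerate : ∀ (x : M) (v : TangentSpace I x), (∀ w, Ω x v w = 0) → v = 0
  closed : ∀ X Y Z : (∀ x : M, TangentSpace I x),
    ContMDiff I I.tangent ∞ (fun x ↦ (⟨x, X x⟩ : TangentBundle I M)) →
    ContMDiff I I.tangent ∞ (fun x ↦ (⟨x, Y x⟩ : TangentBundle I M)) →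
    ContMDiff I I.tangent ∞ (fun x ↦ (⟨x, Z x⟩ : TangentBundle I M)) →
    ∀ x : M,
      mvfderiv I (fun y ↦ Ω y (Y y) (Z y)) x (X x)
        - mvfderiv I (fun y ↦ Ω y (X y) (Z y)) x (Y x)
        + mvfderiv I (fun y ↦ Ω y (X y) (Y y)) x (Z x)
        - Ω x (VectorField.mlieBracket I X Y x) (Z x)
        + Ω x (VectorField.mlieBracket I X Z x) (Y x)
        - Ω x (VectorField.mlieBracket I Y Z x) (X x) = 0

/-- The Hamiltonian vector field `sgrad F`, defined by `Ω(sgrad F, ·) = -dF`. -/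
def sgrad (Ω : BilinField I M) (F : M → ℝ) (x : M) : TangentSpace I x :=
  -(Ω x).inverse (mvfderiv I F x)

/-- Over a finite dimensional manifold with a nondegenerate `Ω`, the vector `sgrad F x` is the
unique one that satisfies `Ω(sgrad F, ·) = -dF`. -/
theorem eq_sgrad_iff [FiniteDimensional ℝ E] (Ω : BilinField I M) (F : M → ℝ) (x : M)
    (hΩ : ∀ v : TangentSpace I x, (∀ w, Ω x v w = 0) → v = 0) (v : TangentSpace I x) :
    v = sgrad Ω F x ↔ ∀ w, Ω x v w = -mvfderiv I F x w := by
  have key : ∀ (A : E →L[ℝ] E →L[ℝ] ℝ) (l : E →L[ℝ] ℝ) (v : E),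
      (∀ v, (∀ w, A v w = 0) → v = 0) → (v = -A.inverse l ↔ ∀ w, A v w = -l w) := by
    intro A l v hA
    have hinj : LinearMap.ker (A : E →ₗ[ℝ] E →L[ℝ] ℝ) = ⊥ := by
      rw [LinearMap.ker_eq_bot']
      intro m hm
      exact hA m fun w ↦ by simpa using congrArg (fun f : E →L[ℝ] ℝ ↦ f w) hm
    have hfr : Module.finrank ℝ E = Module.finrank ℝ (E →L[ℝ] ℝ) :=
      (Subspace.dual_finrank_eq (K := ℝ) (V := E)).symm.trans
        (LinearMap.toContinuousLinearMap (𝕜 := ℝ) (E := E) (F' := ℝ)).finrank_eq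
    let e : E ≃L[ℝ] (E →L[ℝ] ℝ) :=
      (LinearEquiv.ofInjectiveOfFinrankEq (A : E →ₗ[ℝ] E →L[ℝ] ℝ)
        (LinearMap.ker_eq_bot.mp hinj) hfr).toContinuousLinearEquiv
    have he : (e : E →L[ℝ] E →L[ℝ] ℝ) = A := by
      ext v w
      rfl
    rw [← he, ContinuousLinearMap.inverse_equiv]
    constructor
    · rintro rfl w
      simp
    · intro h
      have h2 : e v = -l := by
        ext w
        simpa using h w
      rw [ContinuousLinearEquiv.coe_coe, ← map_neg, ← h2, ContinuousLinearEquiv.symm_apply_apply]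
  exact key (Ω x) (mvfderiv I F x) v hΩ

/-- The Poisson bracket `{F, G} = dF(sgrad G)`. -/
def poissonBracket (Ω : BilinField I M) (F G : M → ℝ) (x : M) : ℝ :=
  mvfderiv I F x (sgrad Ω G x)

/-- The uniform norm of a real function, as an extended nonnegative real number. -/
def uniformNorm (F : M → ℝ) : ENNReal := ⨆ x, ‖F x‖ₑ

/-- The space `C^∞_c` of smooth compactly supported functions. -/
def SmoothCompactlySupported (I : ModelWithCorners ℝ E H) (F : M → ℝ) : Prop :=
  ContMDiff I 𝓘(ℝ, ℝ) ∞ F ∧ HasCompactSupport F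

/-- The class of pairs `(F, G)` of smooth compactly supported functions with `F ≤ 0` on `X₀`,
`F ≥ 1` on `X₁`, `G ≤ 0` on `Y₀` and `G ≥ 1` on `Y₁`. -/
def classF4 (I : ModelWithCorners ℝ E H) (X₀ X₁ Y₀ Y₁ : Set M) : Set ((M → ℝ) × (M → ℝ)) :=
  {P | SmoothCompactlySupported I P.1 ∧ SmoothCompactlySupported I P.2 ∧
    (∀ x ∈ X₀, P.1 x ≤ 0) ∧ (∀ x ∈ X₁, 1 ≤ P.1 x) ∧
    (∀ x ∈ Y₀, P.2 x ≤ 0) ∧ (∀ x ∈ Y₁, 1 ≤ P.2 x)}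

/-- The Poisson bracket invariant of a quadruple of sets: the infimum of `‖{F, G}‖` over the
class `classF4` (equal to `∞` when the class is empty). -/
def pb4 (Ω : BilinField I M) (X₀ X₁ Y₀ Y₁ : Set M) : ENNReal :=
  ⨅ P ∈ classF4 I X₀ X₁ Y₀ Y₁, uniformNorm (poissonBracket Ω P.1 P.2)

/-- The pullback `f^*Ω`. -/
def BilinField.pullback (I' : ModelWithCorners ℝ E' H') (Ω : BilinField I M) (f : N → M) :
    BilinField I' N :=
  fun x ↦ (ContinuousLinearMap.precomp ℝ (mfderiv I' I f x)).comp
    ((Ω (f x)).comp (mfderiv I' I f x))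

/-- The product form `Ω ⊕ σ = pr₁^*Ω + pr₂^*σ` on `M × N`. -/
def BilinField.prod (Ω : BilinField I M) (σ : BilinField I' N) :
    BilinField (I.prod I') (M × N) :=
  fun z ↦ Ω.pullback (I.prod I') Prod.fst z + σ.pullback (I.prod I') Prod.snd z

end General

/-- The point of the circle `S¹` with coordinate `θ (mod 1)`. -/
def circlePt (θ : ℝ) : Circle := Circle.exp (2 * Real.pi * θ)

/-- The `1`-form `dθ` on `S¹ ⊂ ℂ`, where the coordinate `θ (mod 1)` is given by
`z = exp(2πiθ)`: `dθ(v) = Im(z̄ v) / 2π`. -/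
def dTheta (z : Circle) : TangentSpace (𝓡 1) z →L[ℝ] ℝ :=
  (2 * Real.pi)⁻¹ • Complex.imCLM.comp
    ((ContinuousLinearMap.mul ℝ ℂ (starRingEnd ℂ (z : ℂ))).comp
      (mfderiv (𝓡 1) 𝓘(ℝ, ℂ) (fun w : Circle ↦ (w : ℂ)) z))

/-- The model with corners of the cylinder `T^*S¹ = ℝ × S¹` and of its open subsets. -/
abbrev cylModel : ModelWithCorners ℝ (ℝ × EuclideanSpace ℝ (Fin 1))
    (ModelProd ℝ (EuclideanSpace ℝ (Fin 1))) :=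
  𝓘(ℝ, ℝ).prod (𝓡 1)

/-- The `1`-form `dr` on `T^*S¹ = ℝ × S¹`. -/
def cylDr (q : ℝ × Circle) : TangentSpace cylModel q →L[ℝ] ℝ :=
  mvfderiv cylModel Prod.fst q

/-- The `1`-form `dθ` on `T^*S¹ = ℝ × S¹`. -/
def cylDTheta (q : ℝ × Circle) : TangentSpace cylModel q →L[ℝ] ℝ :=
  (dTheta q.2).comp (mfderiv cylModel (𝓡 1) Prod.snd q)

/-- The standard symplectic form `dr ∧ dθ` on `T^*S¹ = ℝ × S¹`. -/
def cylForm : BilinField cylModel (ℝ × Circle) :=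
  fun q ↦ (cylDr q).smulRight (cylDTheta q) - (cylDTheta q).smulRight (cylDr q)

/-- The open annulus `{|r| < R}` in `T^*S¹`, for `R ≤ ∞`. -/
def annulus (R : EReal) : TopologicalSpace.Opens (ℝ × Circle) where
  carrier := {q | ((|q.1| : ℝ) : EReal) < R}
  is_open' := isOpen_lt (continuous_coe_real_ereal.comp continuous_fst.abs) continuous_const

/-- The form `dr ∧ dθ` on the annulus. -/
def annulusForm (R : EReal) : BilinField cylModel (annulus R) :=
  cylForm.pullback cylModel Subtype.val

/-- The `R`-stabilization `X × S¹ ⊂ M × 𝔸_R`, where `S¹` is the zero section `{r = 0}`. -/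
def stab {M : Type*} (R : EReal) (X : Set M) : Set (M × annulus R) :=
  {z | z.1 ∈ X ∧ (z.2 : ℝ × Circle).1 = 0}

/-- `g` is the Hamiltonian flow of the `1`-periodic Hamiltonian `G`, where
`G_t = G(·, t mod 1)`: `g_0 = id` and `d/dt g_t x = (sgrad G_t)(g_t x)` for all `t ∈ ℝ`. -/
def IsHamiltonianFlow {E : Type*} [NormedAddCommGroup E] [NormedSpace ℝ E]
    {H : Type*} [TopologicalSpace H] {I : ModelWithCorners ℝ E H}
    {M : Type*} [TopologicalSpace M] [ChartedSpace H M]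
    (Ω : BilinField I M) (G : M × Circle → ℝ) (g : ℝ → M → M) : Prop :=
  (∀ x, g 0 x = x) ∧
    ∀ x t, HasMFDerivAt 𝓘(ℝ, ℝ) I (fun s ↦ g s x) t
      ((1 : ℝ →L[ℝ] ℝ).smulRight (sgrad Ω (fun y ↦ G (y, circlePt t)) (g t x)))

end

/-!
The proof suspends the time-dependent Hamiltonian `G` to the autonomous vector field
`V = sgrad G_θ + ∂/∂θ` on `M × S¹` (`suspensionField`). It is smooth, because `sgrad` is obtained by
solving a linear system with smooth coefficients (`IsSymplecticForm.contMDiff_sgrad`), and complete,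
because outside a compact set its orbits are circles `{x} × S¹`. Its flow `φ` gives the Hamiltonian
flow of `G`, and conversely each orbit of `φ` projects to a time-shifted orbit of any Hamiltonian
flow of `G` (`IsGlobalFlow.exists_hamiltonian_orbit`). A chord of `G` from `X₀` to `X₁` is thus an
orbit segment of `φ` from `X₀ × S¹` to `X₁ × S¹`.

Suppose that there is no chord of length at most `1/p`. By compactness there is none of length at
most some `T > 1/p`. A cutoff that separates the orbit segments of length `T` issued from `X₀ × S¹`
and from `X₁ × S¹`, averaged over a fine subdivision of `[0, T]` along `φ`, is a function `U` that
is `0` on `X₀ × S¹` and `1` on `X₁ × S¹` and has `|dU(V)| ≤ b`, where `1/T < b < p`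
(`IsGlobalFlow.exists_separating_function`).

On `M × 𝔸_R` the Hamiltonian `s = r + G` has a Hamiltonian vector field that projects to `V` and
is tangent to the levels of `s` (`sgrad_suspensionHamiltonian`). Let `κ` be a cutoff function that
is `1` on the range of `G` and vanishes away from it. Then `F = U κ(s)` satisfies
`{F, s} = κ(s) dU(V)`, and its support is compact, since `|r| = |s - G|` is there at most slightly
larger than `max G - min G < R`. Cutting off `s` away from the support of `F` and from the `Y_i`
gives an admissible pair whose bracket is bounded by `b` (`pb4_stab_le`), contrary to `b < p`.

The smoothness of the flow of a vector field in its initial point, needed for the smoothness of `U`,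
is derived from the implicit function theorem for the integral equation of the flow, in a space of
continuous curves (`exists_contDiff_local_flow`).
-/

/-! ### Superposition operators and a fixed-time local flow in a normed space -/

section Superposition

open Set

universe u

variable {K : Type*} [TopologicalSpace K] [CompactSpace K]
  {E : Type u} [NormedAddCommGroup E] [NormedSpace ℝ E]

/-- Pointwise evaluation `(A, h) ↦ (s ↦ A s (h s))`, as a continuous bilinear map on spaces of
continuous functions. -/
noncomputable def pointwiseApply (K : Type*) [TopologicalSpace K] [CompactSpace K]
    (E F : Type*) [NormedAddCommGroup E] [NormedSpace ℝ E]
    [NormedAddCommGroup F] [NormedSpace ℝ F] :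
    C(K, E →L[ℝ] F) →L[ℝ] C(K, E) →L[ℝ] C(K, F) :=
  LinearMap.mkContinuous₂
    (LinearMap.mk₂ ℝ (fun (A : C(K, E →L[ℝ] F)) (h : C(K, E)) ↦
        (⟨fun s ↦ A s (h s), by fun_prop⟩ : C(K, F)))
      (fun A B h ↦ by ext; simp) (fun c A h ↦ by ext; simp)
      (fun A h k ↦ by ext; simp) (fun c A h ↦ by ext; simp)) 1 (fun A h ↦ by
        rw [ContinuousMap.norm_le _ (by positivity)]
        intro s
        refine ((A s).le_opNorm (h s)).trans ?_
        rw [one_mul]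
        exact mul_le_mul (A.norm_coe_le_norm s) (h.norm_coe_le_norm s) (norm_nonneg _)
          (by positivity))

/-- The superposition operator `γ ↦ f ∘ γ` of a `C^1` function is Fréchet differentiable for the
uniform norm. -/
theorem hasFDerivAt_superposition {F : Type*} [NormedAddCommGroup F] [NormedSpace ℝ F]
    (f : C(E, F)) (f' : C(E, E →L[ℝ] F)) (hf : ∀ x, HasFDerivAt f (f' x) x) (γ : C(K, E)) :
    HasFDerivAt (fun γ : C(K, E) ↦ f.comp γ) (pointwiseApply K E F (f'.comp γ)) γ := by
  rw [hasFDerivAt_iff_isLittleO, Asymptotics.isLittleO_iff]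
  intro ε hε
  have hunif := (isCompact_range γ.continuous).uniformContinuousAt_of_continuousAt f'
    (fun x _ ↦ f'.continuous.continuousAt) (Metric.dist_mem_uniformity hε)
  obtain ⟨δ, hδ, hδ'⟩ := Metric.mem_uniformity_dist.1 hunif
  filter_upwards [Metric.ball_mem_nhds γ hδ] with η hη
  rw [ContinuousMap.norm_le _ (by positivity)]
  intro s
  have hball : ∀ x ∈ Metric.ball (γ s) δ, ‖f' x - f' (γ s)‖ ≤ ε := by
    intro x hx
    have := hδ' (a := γ s) (b := x) (by rw [dist_comm]; exact hx) ⟨s, rfl⟩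
    rw [← dist_eq_norm, dist_comm]
    exact le_of_lt this
  have hs : dist (η s) (γ s) < δ := (ContinuousMap.dist_apply_le_dist s).trans_lt hη
  have := (convex_ball (γ s) δ).norm_image_sub_le_of_norm_hasFDerivWithin_le' (f := f)
    (f' := f') (φ := f' (γ s)) (C := ε) (x := γ s) (y := η s)
    (fun x _ ↦ (hf x).hasFDerivWithinAt) hball (Metric.mem_ball_self hδ) hs
  refine this.trans ?_
  gcongr
  exact (η - γ).norm_coe_le_norm s

/-- The superposition operator of a `C^n` function is `C^n` for the uniform norm. -/
theorem contDiff_superposition (n : ℕ) : ∀ {F : Type u} [NormedAddCommGroup F] [NormedSpace ℝ F]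
    (f : C(E, F)), ContDiff ℝ n (f : E → F) → ContDiff ℝ n (fun γ : C(K, E) ↦ f.comp γ) := by
  induction n with
  | zero =>
    intro F _ _ f _
    exact contDiff_zero.2 (ContinuousMap.continuous_postcomp f)
  | succ n ih =>
    intro F _ _ f hf
    push_cast at hf ⊢
    obtain ⟨f', hf', hd⟩ := contDiff_succ_iff_hasFDerivAt.1 hf
    have hP : ContDiff ℝ n (fun A : C(K, E →L[ℝ] F) ↦ pointwiseApply K E F A) :=
      ContinuousLinearMap.contDiff _
    refine contDiff_succ_iff_hasFDerivAt.2
      ⟨fun γ ↦ pointwiseApply K E F ((⟨f', hf'.continuous⟩ : C(E, E →L[ℝ] F)).comp γ),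
        hP.comp (ih (⟨f', hf'.continuous⟩ : C(E, E →L[ℝ] F)) hf'),
        hasFDerivAt_superposition f ⟨f', hf'.continuous⟩ hd⟩

end Superposition

section LocalFlow

open Set

universe u

variable {E : Type u} [NormedAddCommGroup E] [NormedSpace ℝ E]

theorem neg_two_le_two : (-2 : ℝ) ≤ 2 := by norm_num

/-- The operator `γ ↦ ∫₀ᵗ γ` on continuous curves parametrized by `[-2, 2]`. -/
noncomputable def primitiveCLM (E : Type*) [NormedAddCommGroup E] [NormedSpace ℝ E] :
    C(Icc (-2 : ℝ) 2, E) →L[ℝ] C(Icc (-2 : ℝ) 2, E) :=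
  LinearMap.mkContinuous
    { toFun := fun γ : C(Icc (-2 : ℝ) 2, E) ↦
        ⟨fun t ↦ ∫ s in (0 : ℝ)..t, IccExtend neg_two_le_two γ s,
        (intervalIntegral.continuous_primitive
          (fun a b ↦ (γ.continuous.Icc_extend' (h := neg_two_le_two)).intervalIntegrable a b) 0).comp
            continuous_subtype_val⟩
      map_add' := fun γ η ↦ by
        ext t
        simp only [ContinuousMap.coe_mk, ContinuousMap.add_apply]
        rw [← intervalIntegral.integral_add (γ.continuous.Icc_extend'.intervalIntegrable _ _)
          (η.continuous.Icc_extend'.intervalIntegrable _ _)]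
        rfl
      map_smul' := fun c γ ↦ by
        ext t
        simp only [ContinuousMap.coe_mk, ContinuousMap.smul_apply, RingHom.id_apply]
        rw [← intervalIntegral.integral_smul]
        rfl } 2 (fun γ ↦ by
          rw [ContinuousMap.norm_le _ (by positivity)]
          intro t
          have h := intervalIntegral.norm_integral_le_of_norm_le_const (a := (0 : ℝ)) (b := t)
            (f := IccExtend neg_two_le_two γ) (C := ‖γ‖) (fun s _ ↦ γ.norm_coe_le_norm _)
          refine h.trans ?_
          rw [mul_comm, sub_zero]
          gcongr
          exact abs_le.2 t.2)

theorem primitiveCLM_apply (γ : C(Icc (-2 : ℝ) 2, E)) (t : Icc (-2 : ℝ) 2) :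
    primitiveCLM E γ t = ∫ s in (0 : ℝ)..t, IccExtend neg_two_le_two γ s := rfl

/-- A solution of the integral equation `γ(t) = x + τ ∫₀ᵗ f(γ)` solves `γ' = τ f(γ)`. -/
theorem hasDerivAt_of_integral_eq [CompleteSpace E] (f : C(E, E)) (x : E) (τ : ℝ)
    (γ : C(Icc (-2 : ℝ) 2, E))
    (h : γ - ContinuousMap.const _ x - τ • primitiveCLM E (f.comp γ) = 0)
    {t : ℝ} (ht : t ∈ Ioo (-2 : ℝ) 2) :
    HasDerivAt (IccExtend neg_two_le_two γ : ℝ → E)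
      (τ • f (IccExtend neg_two_le_two γ t)) t := by
  have hc : Continuous (IccExtend neg_two_le_two (f.comp γ)) :=
    (f.comp γ).continuous.Icc_extend'
  have hd := (intervalIntegral.integral_hasDerivAt_right (hc.intervalIntegrable 0 t)
    (hc.stronglyMeasurableAtFilter _ _) hc.continuousAt).const_smul τ |>.const_add x
  refine (hd.congr_of_eventuallyEq ?_)
  filter_upwards [Ioo_mem_nhds ht.1 ht.2] with s hs
  have hs' : s ∈ Icc (-2 : ℝ) 2 := Ioo_subset_Icc_self hs
  have := DFunLike.congr_fun h ⟨s, hs'⟩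
  simp only [ContinuousMap.sub_apply, ContinuousMap.const_apply, ContinuousMap.smul_apply,
    primitiveCLM_apply, ContinuousMap.zero_apply] at this
  rw [IccExtend_of_mem _ _ hs', ← sub_eq_zero, ← this]
  abel

/-- Local flow of a `C^n` vector field on a Banach space, obtained from the implicit function
theorem applied to the integral equation `γ(t) = x + τ ∫₀ᵗ f(γ)` near `τ = 0`. -/
theorem exists_contDiff_local_flow [CompleteSpace E] {n : ℕ} (hn : n ≠ 0) {f : E → E}
    (hf : ContDiff ℝ n f) (y : E) {U : Set E} (hU : U ∈ 𝓝 y) :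
    ∃ ε > 0, ∃ W ∈ 𝓝 y, ∃ c : ℝ → E → E,
      (∀ x ∈ W, c 0 x = x) ∧
      (∀ x ∈ W, ∀ t ∈ Ioo (-ε) ε, c t x ∈ U ∧ HasDerivAt (fun s ↦ c s x) (f (c t x)) t) ∧
      (∀ t ∈ Ioo (-ε) ε, ContDiffOn ℝ n (c t) W) ∧
      ContinuousOn (fun q : ℝ × E ↦ c q.1 q.2) (Ioo (-ε) ε ×ˢ W) := by
  let X := C(Icc (-2 : ℝ) 2, E)
  let fc : C(E, E) := ⟨f, hf.continuous⟩
  let Φ : (E × ℝ) × X → X := fun q ↦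
    q.2 - ContinuousMap.const _ q.1.1 - q.1.2 • primitiveCLM E (fc.comp q.2)
  have hΦt : ∀ q t, Φ q t = q.2 t - q.1.1 -
      q.1.2 • ∫ s in (0 : ℝ)..t, IccExtend neg_two_le_two (fc.comp q.2) s :=
    fun _ _ ↦ rfl
  let constL : E →L[ℝ] X := ContinuousLinearMap.const ℝ _
  have hcL : ∀ x t, constL x t = x := fun _ _ ↦ rfl
  have hω : ContDiff ℝ n (fun γ : X ↦ fc.comp γ) := contDiff_superposition n fc hf
  have hΦ : ContDiff ℝ n Φ := by
    have h1 : ContDiff ℝ n (fun q : (E × ℝ) × X ↦ constL q.1.1) :=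
      constL.contDiff.comp (contDiff_fst.comp contDiff_fst)
    have h2 : ContDiff ℝ n (fun q : (E × ℝ) × X ↦ primitiveCLM E (fc.comp q.2)) :=
      (primitiveCLM E).contDiff.comp (hω.comp contDiff_snd)
    exact (contDiff_snd.sub h1).sub ((contDiff_snd.comp contDiff_fst).smul h2)
  let u : (E × ℝ) × X := ((y, 0), constL y)
  have hu : Φ u = 0 := by
    ext t
    rw [hΦt]
    simp only [u, hcL, zero_smul, sub_self, ContinuousMap.zero_apply]
  have hn' : (n : WithTop ℕ∞) ≠ 0 := by exact_mod_cast hn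
  -- At `τ = 0` the partial derivative in `γ` is the identity.
  have hpart : (fderiv ℝ Φ u ∘L .inr ℝ (E × ℝ) X) = ContinuousLinearMap.id ℝ X := by
    have h1 : HasFDerivAt (fun γ : X ↦ Φ (u.1, γ)) (fderiv ℝ Φ u ∘L .inr ℝ (E × ℝ) X) u.2 :=
      (hΦ.differentiable hn' u).hasFDerivAt.comp u.2 (hasFDerivAt_prodMk_right u.1 u.2)
    have h2 : HasFDerivAt (fun γ : X ↦ Φ (u.1, γ)) (ContinuousLinearMap.id ℝ X) u.2 := by
      have : (fun γ : X ↦ Φ (u.1, γ)) = fun γ ↦ γ - constL y := by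
        ext γ t
        rw [hΦt]
        simp only [u, zero_smul, sub_zero]
        rfl
      rw [this]
      exact (hasFDerivAt_id _).sub_const _
    exact h1.unique h2
  have hinv : (fderiv ℝ Φ u ∘L .inr ℝ (E × ℝ) X).IsInvertible := by
    rw [hpart]
    exact ⟨ContinuousLinearEquiv.refl ℝ X, rfl⟩
  have hcd : ContDiffAt ℝ n Φ u := hΦ.contDiffAt
  let ψ : E × ℝ → X := hcd.implicitFunction hn' hinv
  have hψ0 : ψ (y, 0) = constL y := hcd.implicitFunction_apply_self hn' hinv
  have hψeq : ∀ᶠ q in 𝓝 (y, (0 : ℝ)), Φ (q, ψ q) = 0 := by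
    have := hcd.eventually_apply_implicitFunction hn' hinv
    rw [hu] at this
    exact this
  have hψd : ContDiffAt ℝ n ψ (y, 0) := hcd.contDiffAt_implicitFunction hn' hinv
  have hψd' : ∀ᶠ q in 𝓝 (y, (0 : ℝ)), ContDiffAt ℝ n ψ q :=
    hψd.eventually (by simp)
  -- For the uniform norm, curves near the constant curve `y` stay in `U`.
  have hψU : ∀ᶠ q in 𝓝 (y, (0 : ℝ)), ∀ t, ψ q t ∈ U := by
    obtain ⟨δ, hδ, hδU⟩ := Metric.mem_nhds_iff.1 hU
    have : ∀ᶠ q in 𝓝 (y, (0 : ℝ)), ψ q ∈ Metric.ball (constL y) δ := by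
      refine hψd.continuousAt.eventually_mem ?_
      rw [hψ0]
      exact Metric.ball_mem_nhds _ hδ
    filter_upwards [this] with q hq t
    exact hδU ((ContinuousMap.dist_apply_le_dist (g := constL y) t).trans_lt hq)
  obtain ⟨W, hW, S, hS, hWS⟩ := mem_nhds_prod_iff.1 ((hψeq.and hψd').and hψU)
  obtain ⟨ε, hε, hεS⟩ : ∃ ε > 0, ε ∈ S := by
    obtain ⟨δ, hδ, hδS⟩ := Metric.mem_nhds_iff.1 hS
    refine ⟨δ / 2, by positivity, hδS ?_⟩
    rw [Metric.mem_ball, Real.dist_eq, sub_zero, abs_of_pos (by positivity)]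
    linarith
  have hmem : ∀ x ∈ W, (Φ ((x, ε), ψ (x, ε)) = 0 ∧ ContDiffAt ℝ n ψ (x, ε)) ∧
      ∀ t, ψ (x, ε) t ∈ U := fun x hx ↦ hWS (mk_mem_prod hx hεS)
  have hψW : ContDiffOn ℝ n (fun x ↦ ψ (x, ε)) W := fun x hx ↦
    ((hmem x hx).1.2.comp x (contDiffAt_id.prodMk contDiffAt_const)).contDiffWithinAt
  have hsc : ∀ t ∈ Ioo (-ε) ε, t / ε ∈ Ioo (-2 : ℝ) 2 := by
    intro t ht
    constructor
    · rw [lt_div_iff₀ hε]; linarith [ht.1]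
    · rw [div_lt_iff₀ hε]; linarith [ht.2]
  refine ⟨ε, hε, W, hW, fun t x ↦ IccExtend neg_two_le_two (ψ (x, ε)) (t / ε), ?_, ?_, ?_, ?_⟩
  · intro x hx
    have h0 : (0 : ℝ) ∈ Icc (-2 : ℝ) 2 := by constructor <;> norm_num
    have := DFunLike.congr_fun (hmem x hx).1.1 ⟨0, h0⟩
    rw [hΦt] at this
    simp only [intervalIntegral.integral_same, smul_zero,
      sub_zero] at this
    beta_reduce
    rw [zero_div, IccExtend_of_mem _ _ h0]
    exact sub_eq_zero.1 this
  · intro x hx t ht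
    refine ⟨(hmem x hx).2 _, ?_⟩
    have h := hasDerivAt_of_integral_eq fc x ε (ψ (x, ε)) (hmem x hx).1.1 (hsc t ht)
    have h2 := h.scomp t ((hasDerivAt_id t).div_const ε)
    convert! h2 using 1
    rw [smul_smul, one_div, inv_mul_cancel₀ hε.ne', one_smul]
    rfl
  · intro t ht
    exact (ContinuousMap.evalCLM ℝ (projIcc (-2 : ℝ) 2
      neg_two_le_two (t / ε))).contDiff.comp_contDiffOn hψW
  · have h1 : ContinuousOn (fun q : ℝ × E ↦ ψ (q.2, ε)) (Ioo (-ε) ε ×ˢ W) :=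
      hψW.continuousOn.comp continuousOn_snd (fun q hq ↦ hq.2)
    have h2 : Continuous (fun q : ℝ × E ↦ projIcc (-2 : ℝ) 2 neg_two_le_two (q.1 / ε)) :=
      continuous_projIcc.comp (by fun_prop)
    exact (ContinuousEval.continuous_eval.comp_continuousOn (h1.prodMk h2.continuousOn))

end LocalFlow

/-! ### Global flows of vector fields on manifolds -/

section ManifoldFlow

open Set

universe u

variable {E : Type u} [NormedAddCommGroup E] [NormedSpace ℝ E]
  {H : Type*} [TopologicalSpace H] {I : ModelWithCorners ℝ E H} [I.Boundaryless]
  {N : Type*} [TopologicalSpace N] [ChartedSpace H N] [IsManifold I ∞ N]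
  {v : ∀ x : N, TangentSpace I x}

/-- Near a point of a chart's target, the coordinate expression of a smooth vector field extends
to a `C^n` vector field on the whole model space. -/
theorem exists_contDiff_eq_coordinate_field [FiniteDimensional ℝ E]
    (hv : ContMDiff I I.tangent ∞ (fun x ↦ (⟨x, v x⟩ : TangentBundle I N))) (z : N) (n : ℕ) :
    ∃ f : E → E, ContDiff ℝ n f ∧ ∀ᶠ y in 𝓝 (extChartAt I z z), f y =
      tangentCoordChange I ((extChartAt I z).symm y) z ((extChartAt I z).symm y)
        (v ((extChartAt I z).symm y)) := by
  have : IsManifold I 1 N := .of_le (n := ∞) (by simp)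
  have h := (contMDiffAt_iff.1 (hv z)).2
  rw [I.range_eq_univ, contDiffWithinAt_univ] at h
  let f₀ : E → E := fun y ↦ tangentCoordChange I ((extChartAt I z).symm y) z
    ((extChartAt I z).symm y) (v ((extChartAt I z).symm y))
  have hf₀ : ContDiffAt ℝ n f₀ (extChartAt I z z) := (h.snd).of_le (by exact_mod_cast le_top)
  obtain ⟨u, hu, hfu⟩ := hf₀.contDiffOn (m := n) le_rfl (by simp)
  obtain ⟨δ, hδ, hδu⟩ := Metric.mem_nhds_iff.1 hu
  let b : ContDiffBump (extChartAt I z z) := ⟨δ / 4, δ / 2, by positivity, by linarith⟩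
  refine ⟨fun y ↦ b y • f₀ y, ?_, ?_⟩
  · rw [← contMDiff_iff_contDiff]
    refine contMDiff_of_tsupport fun y hy ↦ ?_
    rw [contMDiffAt_iff_contDiffAt]
    refine b.contDiffAt.smul (hfu.contDiffAt (Filter.mem_of_superset ?_ hδu))
    have hy' : y ∈ tsupport b := closure_mono (Function.support_smul_subset_left _ _) hy
    rw [b.tsupport_eq, Metric.mem_closedBall] at hy'
    refine Metric.isOpen_ball.mem_nhds (hy'.trans_lt ?_)
    change δ / 2 < δ
    linarith
  · filter_upwards [b.eventuallyEq_one] with y hy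
    rw [hy, Pi.one_apply, one_smul]

/-- If `ζ` solves the coordinate form of the equation of an integral curve, then its image in the
manifold is an integral curve. -/
theorem hasMFDerivAt_of_coordinate (z : N) {ζ : ℝ → E} {t : ℝ}
    (ht : ζ t ∈ (extChartAt I z).target)
    (h : HasDerivAt ζ (tangentCoordChange I ((extChartAt I z).symm (ζ t)) z
      ((extChartAt I z).symm (ζ t)) (v ((extChartAt I z).symm (ζ t)))) t) :
    HasMFDerivAt 𝓘(ℝ, ℝ) I (fun s ↦ (extChartAt I z).symm (ζ s)) t
      ((1 : ℝ →L[ℝ] ℝ).smulRight (v ((extChartAt I z).symm (ζ t)))) := by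
  have : IsManifold I 1 N := .of_le (n := ∞) (by simp)
  let xₜ : N := (extChartAt I z).symm (ζ t)
  have hft1 : xₜ ∈ (extChartAt I z).source := (extChartAt I z).map_target ht
  have hft2 := mem_extChartAt_source (I := I) xₜ
  suffices h' : HasDerivAt ((extChartAt I xₜ ∘ (extChartAt I z).symm) ∘ ζ) (v xₜ : E) t by
    refine ⟨(continuousAt_extChartAt_symm'' ht).comp h.continuousAt, ?_⟩
    have h4 := h'.hasFDerivAt.hasFDerivWithinAt (s := range 𝓘(ℝ, ℝ))
    exact h4
  have key : ∀ w : E, tangentCoordChange I z xₜ xₜ (tangentCoordChange I xₜ z xₜ w) = w :=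
    fun w ↦ by rw [tangentCoordChange_comp ⟨⟨hft2, hft1⟩, hft2⟩, tangentCoordChange_self hft2]
  have h3 := hasFDerivWithinAt_tangentCoordChange (I := I) ⟨hft1, hft2⟩
  rw [I.range_eq_univ, hasFDerivWithinAt_univ] at h3
  rw [show extChartAt I z xₜ = ζ t from (extChartAt I z).right_inv ht] at h3
  exact (h3.comp_hasDerivAt t h).congr_deriv (key _)

/-- Every point has a neighbourhood on which the integral curves of a smooth vector field are
defined for a uniform time and depend `C^n` on the initial point. -/
theorem exists_contMDiff_local_flow [FiniteDimensional ℝ E]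
    (hv : ContMDiff I I.tangent ∞ (fun x ↦ (⟨x, v x⟩ : TangentBundle I N))) (z : N) {n : ℕ}
    (hn : n ≠ 0) :
    ∃ ε > 0, ∃ W ∈ 𝓝 z, ∃ c : ℝ → N → N,
      (∀ x ∈ W, c 0 x = x) ∧
      (∀ x ∈ W, IsMIntegralCurveOn (fun s ↦ c s x) v (Ioo (-ε) ε)) ∧
      (∀ t ∈ Ioo (-ε) ε, ContMDiffOn I I n (c t) W) ∧
      ContinuousOn (fun q : ℝ × N ↦ c q.1 q.2) (Ioo (-ε) ε ×ˢ W) := by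
  have : IsManifold I 1 N := .of_le (n := ∞) (by simp)
  have : IsManifold I n N := .of_le (n := ∞) (by exact_mod_cast le_top)
  obtain ⟨f, hf, hfv⟩ := exists_contDiff_eq_coordinate_field hv z n
  obtain ⟨ε, hε, W, hW, c, hc0, hcd, hcn, hcc⟩ := exists_contDiff_local_flow hn hf
    (extChartAt I z z) (Filter.inter_mem hfv (extChartAt_target_mem_nhds (I := I) z))
  let e := extChartAt I z
  have hmaps : MapsTo e (e.source ∩ e ⁻¹' W) W := fun x hx ↦ hx.2
  have hec : ContMDiffOn I 𝓘(ℝ, E) n e (e.source ∩ e ⁻¹' W) := by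
    refine (contMDiffOn_extChartAt (I := I) (x := z)).mono fun x hx ↦ ?_
    rw [← extChartAt_source I]
    exact hx.1
  refine ⟨ε, hε, e.source ∩ e ⁻¹' W, Filter.inter_mem (extChartAt_source_mem_nhds z)
    ((continuousAt_extChartAt z).preimage_mem_nhds hW), fun t x ↦ e.symm (c t (e x)),
    ?_, ?_, ?_, ?_⟩
  · rintro x ⟨hx, hxW⟩
    beta_reduce
    rw [hc0 _ hxW]
    exact e.left_inv hx
  · rintro x ⟨hx, hxW⟩ t ht
    obtain ⟨⟨h1, h2⟩, h3⟩ := hcd _ hxW t ht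
    rw [mem_ofPred_eq] at h1
    rw [h1] at h3
    exact (hasMFDerivAt_of_coordinate z h2 h3).hasMFDerivWithinAt
  · intro t ht
    exact (contMDiffOn_extChartAt_symm (I := I) (n := n) z).comp
      ((contMDiffOn_iff_contDiffOn.2 (hcn t ht)).comp hec hmaps)
      fun x hx ↦ (hcd _ hx.2 t ht).1.2
  · refine (continuousOn_extChartAt_symm (I := I) z).comp
      (hcc.comp (continuousOn_fst.prodMk (hec.continuousOn.comp continuousOn_snd
        fun q hq ↦ hq.2)) fun q hq ↦ ⟨hq.1, hq.2.2⟩) fun q hq ↦ (hcd _ hq.2.2 _ hq.1).1.2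

/-- `φ` is the flow of the autonomous vector field `v`, defined for all times. -/
structure IsGlobalFlow (v : ∀ x : N, TangentSpace I x) (φ : ℝ → N → N) : Prop where
  zero : ∀ x, φ 0 x = x
  curve : ∀ x, IsMIntegralCurve (fun t ↦ φ t x) v

/-- A smooth vector field is complete if all its integral curves that start outside some compact
set are defined for all times. -/
theorem exists_isGlobalFlow_of_isCompact [FiniteDimensional ℝ E] [T2Space N]
    (hv : ContMDiff I I.tangent ∞ (fun x ↦ (⟨x, v x⟩ : TangentBundle I N)))
    {K : Set N} (hK : IsCompact K)
    (hKc : ∀ x ∉ K, ∃ γ : ℝ → N, γ 0 = x ∧ IsMIntegralCurve γ v) :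
    ∃ φ : ℝ → N → N, IsGlobalFlow v φ := by
  have : IsManifold I 1 N := .of_le (n := ∞) (by simp)
  have hv1 : ContMDiff I I.tangent 1 (fun x ↦ (⟨x, v x⟩ : TangentBundle I N)) :=
    hv.of_le (by simp)
  obtain ⟨ε, hε, hεK⟩ : ∃ ε > 0, ∀ x ∈ K, ∃ γ : ℝ → N, γ 0 = x ∧
      IsMIntegralCurveOn γ v (Ioo (-ε) ε) := by
    refine hK.induction_on (p := fun A ↦ ∃ ε > 0, ∀ x ∈ A, ∃ γ : ℝ → N, γ 0 = x ∧
      IsMIntegralCurveOn γ v (Ioo (-ε) ε)) ⟨1, one_pos, by simp⟩ ?_ ?_ ?_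
    · rintro A B hAB ⟨ε, hε, h⟩
      exact ⟨ε, hε, fun x hx ↦ h x (hAB hx)⟩
    · rintro A B ⟨ε, hε, h⟩ ⟨ε', hε', h'⟩
      refine ⟨min ε ε', lt_min hε hε', fun x hx ↦ ?_⟩
      rcases hx with hx | hx
      · obtain ⟨γ, h0, h1⟩ := h x hx
        exact ⟨γ, h0, h1.mono (Ioo_subset_Ioo (neg_le_neg (min_le_left _ _)) (min_le_left _ _))⟩
      · obtain ⟨γ, h0, h1⟩ := h' x hx
        exact ⟨γ, h0, h1.mono (Ioo_subset_Ioo (neg_le_neg (min_le_right _ _)) (min_le_right _ _))⟩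
    · intro z _
      obtain ⟨ε, hε, W, hW, c, hc0, hc, -⟩ := exists_contMDiff_local_flow hv z one_ne_zero
      exact ⟨W, mem_nhdsWithin_of_mem_nhds hW, ε, hε, fun x hx ↦ ⟨_, hc0 x hx, hc x hx⟩⟩
  have hglob := exists_isMIntegralCurve_of_isMIntegralCurveOn hv1 hε fun x ↦ by
    by_cases hx : x ∈ K
    · exact hεK x hx
    · obtain ⟨γ, h0, h1⟩ := hKc x hx
      exact ⟨γ, h0, h1.isMIntegralCurveOn _⟩
  choose γ h0 h1 using hglob
  exact ⟨fun t x ↦ γ x t, h0, h1⟩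

namespace IsGlobalFlow

variable {φ : ℝ → N → N}

/-- Uniqueness: an integral curve that passes through `x` at time `s` is the orbit of `x`,
shifted by `s`. -/
theorem eq_of_isMIntegralCurve [T2Space N] (hφ : IsGlobalFlow v φ)
    (hv : ContMDiff I I.tangent ∞ (fun x ↦ (⟨x, v x⟩ : TangentBundle I N)))
    {γ : ℝ → N} (hγ : IsMIntegralCurve γ v) {s : ℝ} (t : ℝ) :
    φ t (γ s) = γ (t + s) := by
  have : IsManifold I 1 N := .of_le (n := ∞) (by simp)
  have := isMIntegralCurve_Ioo_eq_of_contMDiff_boundaryless (t₀ := 0) (hv.of_le (by simp))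
    (hφ.curve (γ s)) (hγ.comp_add s) (by simp [hφ.zero])
  exact congrFun this t

theorem add [T2Space N] (hφ : IsGlobalFlow v φ)
    (hv : ContMDiff I I.tangent ∞ (fun x ↦ (⟨x, v x⟩ : TangentBundle I N))) (s t : ℝ) (x : N) :
    φ (s + t) x = φ s (φ t x) :=
  (hφ.eq_of_isMIntegralCurve hv (hφ.curve x) (s := t) s).symm

/-- Near each point, and for a short time, a global flow is `C^n`. -/
theorem exists_contMDiffOn [FiniteDimensional ℝ E] [T2Space N] (hφ : IsGlobalFlow v φ)
    (hv : ContMDiff I I.tangent ∞ (fun x ↦ (⟨x, v x⟩ : TangentBundle I N))) (z : N) {n : ℕ}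
    (hn : n ≠ 0) :
    ∃ ε > 0, ∃ W ∈ 𝓝 z, (∀ t ∈ Ioo (-ε) ε, ContMDiffOn I I n (φ t) W) ∧
      ContinuousOn (fun q : ℝ × N ↦ φ q.1 q.2) (Ioo (-ε) ε ×ˢ W) := by
  have : IsManifold I 1 N := .of_le (n := ∞) (by simp)
  obtain ⟨ε, hε, W, hW, c, hc0, hc, hcn, hcc⟩ := exists_contMDiff_local_flow hv z hn
  have heq : ∀ x ∈ W, ∀ t ∈ Ioo (-ε) ε, φ t x = c t x := by
    intro x hx t ht
    exact isMIntegralCurveOn_Ioo_eqOn_of_contMDiff_boundaryless (t₀ := 0) (by simp [hε])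
      (hv.of_le (by simp)) ((hφ.curve x).isMIntegralCurveOn _) (hc x hx)
      (by simp [hφ.zero, hc0 x hx]) ht
  exact ⟨ε, hε, W, hW, fun t ht ↦ (hcn t ht).congr fun x hx ↦ heq x hx t ht,
    hcc.congr fun q hq ↦ heq q.2 hq.2 q.1 hq.1⟩

/-- The time `t` map of the flow of a smooth vector field is smooth. It is a composition of
maps of small times, and the time for which the flow is known to be smooth is bounded below along
the compact orbit segment. -/
theorem contMDiff [FiniteDimensional ℝ E] [T2Space N] (hφ : IsGlobalFlow v φ)
    (hv : ContMDiff I I.tangent ∞ (fun x ↦ (⟨x, v x⟩ : TangentBundle I N))) (t : ℝ) :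
    ContMDiff I I ∞ (φ t) := by
  rw [contMDiff_infty]
  intro n
  suffices h : ContMDiff I I (n + 1 : ℕ) (φ t) from h.of_le (by exact_mod_cast n.le_succ)
  intro z
  obtain ⟨ε, hε, hεS⟩ : ∃ ε > 0, ∀ x ∈ (fun s ↦ φ (s * t) z) '' Icc (0 : ℝ) 1,
      ∀ s ∈ Ioo (-ε) ε, ContMDiffAt I I (n + 1 : ℕ) (φ s) x := by
    have hS : IsCompact ((fun s ↦ φ (s * t) z) '' Icc (0 : ℝ) 1) :=
      isCompact_Icc.image ((hφ.curve z).continuous.comp (continuous_mul_const t))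
    refine hS.induction_on (p := fun A ↦ ∃ ε > 0, ∀ x ∈ A,
      ∀ s ∈ Ioo (-ε) ε, ContMDiffAt I I (n + 1 : ℕ) (φ s) x) ⟨1, one_pos, by simp⟩ ?_ ?_ ?_
    · rintro A B hAB ⟨ε, hε, h⟩
      exact ⟨ε, hε, fun x hx ↦ h x (hAB hx)⟩
    · rintro A B ⟨ε, hε, h⟩ ⟨ε', hε', h'⟩
      refine ⟨min ε ε', lt_min hε hε', fun x hx s hs ↦ ?_⟩
      rcases hx with hx | hx
      · exact h x hx s (Ioo_subset_Ioo (neg_le_neg (min_le_left _ _)) (min_le_left _ _) hs)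
      · exact h' x hx s (Ioo_subset_Ioo (neg_le_neg (min_le_right _ _)) (min_le_right _ _) hs)
    · intro y _
      obtain ⟨ε, hε, W, hW, h1, -⟩ := hφ.exists_contMDiffOn hv y n.succ_ne_zero
      exact ⟨interior W, mem_nhdsWithin_of_mem_nhds (interior_mem_nhds.2 hW), ε, hε,
        fun x hx s hs ↦ (h1 s hs).contMDiffAt (mem_interior_iff_mem_nhds.1 hx)⟩
  obtain ⟨m, hm⟩ := exists_nat_gt (|t| / ε)
  have hm0 : (0 : ℝ) < m := lt_of_le_of_lt (by positivity) hm
  have hstep : t / m ∈ Ioo (-ε) ε := by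
    rw [mem_Ioo, ← abs_lt, abs_div, abs_of_pos hm0, div_lt_iff₀ hm0, mul_comm]
    exact (div_lt_iff₀ hε).1 hm
  have hk : ∀ k : ℕ, k ≤ m → ContMDiffAt I I (n + 1 : ℕ) (φ ((k / m : ℝ) * t)) z := by
    intro k
    induction k with
    | zero =>
      intro _
      have : φ (((0 : ℕ) / m : ℝ) * t) = id := by
        ext x
        simp [hφ.zero]
      rw [this]
      exact contMDiffAt_id
    | succ k ih =>
      intro hkm
      have hfun : φ (((k + 1 : ℕ) / m : ℝ) * t) = φ (t / m) ∘ φ ((k / m : ℝ) * t) := by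
        ext x
        rw [Function.comp_apply, ← hφ.add hv]
        congr 1
        push_cast
        ring
      rw [hfun]
      refine ContMDiffAt.comp z (hεS _ ⟨k / m, ⟨by positivity, ?_⟩, rfl⟩ _ hstep)
        (ih (by omega))
      rw [div_le_one hm0]
      exact_mod_cast (by omega : k ≤ m)
  have := hk m le_rfl
  rwa [div_self hm0.ne', one_mul] at this

theorem continuous_uncurry [FiniteDimensional ℝ E] [T2Space N] (hφ : IsGlobalFlow v φ)
    (hv : ContMDiff I I.tangent ∞ (fun x ↦ (⟨x, v x⟩ : TangentBundle I N))) :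
    Continuous fun q : ℝ × N ↦ φ q.1 q.2 := by
  rw [continuous_iff_continuousAt]
  rintro ⟨t, z⟩
  obtain ⟨ε, hε, W, hW, -, h2⟩ := hφ.exists_contMDiffOn hv (φ t z) one_ne_zero
  have h3 : ContinuousAt (fun q : ℝ × N ↦ φ q.1 q.2) (0, φ t z) :=
    h2.continuousAt (prod_mem_nhds (Ioo_mem_nhds (by linarith) hε) hW)
  have h4 : ContinuousAt (fun q : ℝ × N ↦ (q.1 - t, φ t q.2)) (t, z) :=
    ((continuous_fst.sub continuous_const).prodMk
      ((hφ.contMDiff hv t).continuous.comp continuous_snd)).continuousAt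
  have h5 : ContinuousAt ((fun q : ℝ × N ↦ φ q.1 q.2) ∘
      fun q : ℝ × N ↦ (q.1 - t, φ t q.2)) (t, z) :=
    ContinuousAt.comp (by simpa using h3) h4
  refine h5.congr (Filter.Eventually.of_forall fun q ↦ ?_)
  simp only [Function.comp_apply]
  rw [← hφ.add hv, sub_add_cancel]

end IsGlobalFlow

end ManifoldFlow

/-! ### Averaging a function along a flow -/

section Averaging

open Set

/-- A function that increases by at most `1` over `[0, nh]` and whose second derivative is bounded
by `C` has an average slope, at the points `0, h, …, (n-1)h`, of size at most
`1/(nh) + Ch`. -/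
theorem abs_average_deriv_le {g g' g'' : ℝ → ℝ} (hg : ∀ t, HasDerivAt g (g' t) t)
    (hg' : ∀ t, HasDerivAt g' (g'' t) t) {C : ℝ} (hC : ∀ t, |g'' t| ≤ C)
    (h01 : ∀ t, g t ∈ Icc (0 : ℝ) 1) {h : ℝ} (hh : 0 < h) {n : ℕ} (hn : n ≠ 0) :
    |(n : ℝ)⁻¹ * ∑ k ∈ Finset.range n, g' (k * h)| ≤ 1 / (n * h) + C * h := by
  have hlip : ∀ a s, |g' s - g' a| ≤ C * |s - a| := fun a s ↦
    convex_univ.norm_image_sub_le_of_norm_hasDerivWithin_le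
      (fun x _ ↦ (hg' x).hasDerivWithinAt) (fun x _ ↦ hC x) (mem_univ a) (mem_univ s)
  have hC0 : 0 ≤ C := (abs_nonneg _).trans (hC 0)
  have hstep : ∀ a, |g (a + h) - g a - h * g' a| ≤ C * h * h := by
    intro a
    have := (convex_Icc a (a + h)).norm_image_sub_le_of_norm_hasDerivWithin_le
      (f := fun s ↦ g s - s * g' a) (f' := fun s ↦ g' s - g' a) (C := C * h) (x := a)
      (y := a + h)
      (fun x _ ↦ ((hg x).sub ((hasDerivAt_id x).mul_const (g' a)) |>.congr_deriv
        (by ring)).hasDerivWithinAt)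
      (fun x hx ↦ (hlip a x).trans (by
        gcongr
        rw [abs_le]
        constructor <;> linarith [hx.1, hx.2])) (by simp [hh.le]) (by simp [hh.le])
    rw [add_sub_cancel_left, Real.norm_eq_abs, Real.norm_eq_abs, abs_of_pos hh] at this
    convert! this using 2
    ring
  have hsum : |g (n * h) - g 0 - h * ∑ k ∈ Finset.range n, g' (k * h)| ≤ n * (C * h * h) := by
    have htel : g (n * h) - g 0 - h * ∑ k ∈ Finset.range n, g' (k * h) =
        ∑ k ∈ Finset.range n, (g (k * h + h) - g (k * h) - h * g' (k * h)) := by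
      rw [Finset.sum_sub_distrib, Finset.mul_sum]
      congr 1
      have := Finset.sum_range_sub (fun k : ℕ ↦ g (k * h)) n
      simp only [Nat.cast_zero, zero_mul] at this
      rw [← this]
      refine Finset.sum_congr rfl fun k _ ↦ ?_
      push_cast
      rw [add_mul, one_mul]
    rw [htel]
    refine (Finset.abs_sum_le_sum_abs _ _).trans ?_
    refine (Finset.sum_le_sum fun (k : ℕ) _ ↦ hstep (k * h)).trans ?_
    simp
  have hn0 : (0 : ℝ) < n := by positivity
  have h1 : |h * ∑ k ∈ Finset.range n, g' (k * h)| ≤ 1 + n * (C * h * h) := by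
    have h2 := h01 (n * h)
    have h3 := h01 0
    rw [abs_le] at hsum ⊢
    constructor <;> linarith [h2.1, h2.2, h3.1, h3.2, hsum.1, hsum.2]
  have h4 : (n : ℝ)⁻¹ * ∑ k ∈ Finset.range n, g' (k * h) =
      (h * ∑ k ∈ Finset.range n, g' (k * h)) / (n * h) := by
    rw [mul_comm (n : ℝ) h, mul_div_mul_left _ _ hh.ne', inv_mul_eq_div]
  rw [h4, abs_div, abs_of_pos (by positivity : 0 < n * h), div_le_iff₀ (by positivity)]
  refine h1.trans (le_of_eq ?_)
  field_simp

universe u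

variable {E : Type u} [NormedAddCommGroup E] [NormedSpace ℝ E]
  {H : Type*} [TopologicalSpace H] {I : ModelWithCorners ℝ E H}
  {N : Type*} [TopologicalSpace N] [ChartedSpace H N]

/-- A smooth compactly supported cutoff, equal to `1` near a compact set and supported in a given
open neighbourhood of it. -/
theorem exists_contMDiff_cutoff [FiniteDimensional ℝ E] [T2Space N] [SigmaCompactSpace N]
    (I : ModelWithCorners ℝ E H) [IsManifold I ∞ N] {K O : Set N} (hK : IsCompact K)
    (hO : IsOpen O) (hKO : K ⊆ O) :
    ∃ f : N → ℝ, ContMDiff I 𝓘(ℝ, ℝ) ∞ f ∧ HasCompactSupport f ∧ (∀ᶠ x in 𝓝ˢ K, f x = 1) ∧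
      (∀ x ∉ O, f x = 0) ∧ ∀ x, f x ∈ Icc (0 : ℝ) 1 := by
  have := Manifold.locallyCompact_of_finiteDimensional (M := N) I
  obtain ⟨L, hL, hKL, hLO⟩ := exists_compact_between hK hO hKO
  obtain ⟨f, h1, h0, h01⟩ := exists_contMDiffMap_one_nhds_of_subset_interior I (n := ⊤)
    hK.isClosed hKL
  exact ⟨f, f.contMDiff, HasCompactSupport.intro hL h0, h1, fun x hx ↦ h0 x fun hxL ↦ hx (hLO hxL),
    h01⟩

/-- The derivative of a smooth function along a smooth vector field is smooth. -/
theorem contMDiff_mvfderiv_apply [IsManifold I ∞ N] {v : ∀ x : N, TangentSpace I x}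
    (hv : ContMDiff I I.tangent ∞ (fun x ↦ (⟨x, v x⟩ : TangentBundle I N)))
    {f : N → ℝ} (hf : ContMDiff I 𝓘(ℝ, ℝ) ∞ f) :
    ContMDiff I 𝓘(ℝ, ℝ) ∞ (fun x ↦ mvfderiv I f x (v x)) :=
  (contMDiff_snd_tangentBundle_modelSpace ℝ 𝓘(ℝ, ℝ)).comp
    ((hf.contMDiff_tangentMap (m := ∞) (by simp)).comp hv)

theorem mvfderiv_eq_zero_of_notMem_tsupport {f : N → ℝ} {x : N}
    (hx : x ∉ tsupport f) : mvfderiv I f x = 0 := by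
  have h : f =ᶠ[𝓝 x] fun _ ↦ 0 := notMem_tsupport_iff_eventuallyEq.1 hx
  rw [mvfderiv, h.mfderiv_eq, mfderiv_const]
  rfl

theorem hasCompactSupport_mvfderiv_apply [T2Space N] {v : ∀ x : N, TangentSpace I x} {f : N → ℝ}
    (hf : HasCompactSupport f) : HasCompactSupport (fun x ↦ mvfderiv I f x (v x)) :=
  HasCompactSupport.intro hf fun x hx ↦ by
    rw [mvfderiv_eq_zero_of_notMem_tsupport hx]
    rfl

/-- Along an integral curve of `v`, the derivative of a function is its derivative in the direction
of `v`. -/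
theorem hasDerivAt_comp_integralCurve {v : ∀ x : N, TangentSpace I x} {γ : ℝ → N}
    (hγ : IsMIntegralCurve γ v) {f : N → ℝ} (hf : ContMDiff I 𝓘(ℝ, ℝ) ∞ f) (t : ℝ) :
    HasDerivAt (fun s ↦ f (γ s)) (mvfderiv I f (γ t) (v (γ t))) t := by
  have h1 := ((hf.mdifferentiableAt (x := γ t) (by simp)).hasMFDerivAt).comp t (hγ t)
  let L : ℝ →L[ℝ] ℝ :=
    (mvfderiv I f (γ t)).comp ((1 : ℝ →L[ℝ] ℝ).smulRight (v (γ t)))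
  have h2 : HasFDerivAt (fun s ↦ f (γ s)) L t := HasMFDerivAt.hasFDerivAt h1
  refine h2.hasDerivAt.congr_deriv ?_
  change mfderiv I 𝓘(ℝ, ℝ) f (γ t) ((1 : ℝ) • v (γ t)) = _
  rw [one_smul]
  rfl

/-- If no orbit of the flow of `v` goes from `K₀` to `K₁` or back within time `T`, then `K₀` and
`K₁` are separated by a smooth compactly supported function whose derivative along `v` is as close
to `1/T` as desired. The function is the average over the times `0, T/n, 2T/n, …` of a cutoff that
separates the orbit segments of length `T` that start at `K₀` and at `K₁`. -/
theorem IsGlobalFlow.exists_separating_function [FiniteDimensional ℝ E] [T2Space N]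
    [IsManifold I ∞ N] [I.Boundaryless] [SigmaCompactSpace N]
    {v : ∀ x : N, TangentSpace I x} {φ : ℝ → N → N} (hφ : IsGlobalFlow v φ)
    (hv : ContMDiff I I.tangent ∞ (fun x ↦ (⟨x, v x⟩ : TangentBundle I N)))
    {K₀ K₁ : Set N} (hK₀ : IsCompact K₀) (hK₁ : IsCompact K₁) {T : ℝ} (hT : 0 < T)
    (hchord : ∀ t, |t| ≤ T → ∀ z ∈ K₀, φ t z ∉ K₁) {b : ℝ} (hb : 1 / T < b) :
    ∃ U : N → ℝ, ContMDiff I 𝓘(ℝ, ℝ) ∞ U ∧ HasCompactSupport U ∧ (∀ z ∈ K₀, U z = 0) ∧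
      (∀ z ∈ K₁, U z = 1) ∧ ∀ z, |mvfderiv I U z (v z)| ≤ b := by
  have hcont := hφ.continuous_uncurry hv
  let A : Set N → Set N := fun K ↦ (fun q : ℝ × N ↦ φ q.1 q.2) '' (Icc 0 T ×ˢ K)
  have hA : ∀ K, IsCompact K → IsCompact (A K) := fun K hK ↦
    (isCompact_Icc.prod hK).image hcont
  have hdisj : A K₁ ⊆ (A K₀)ᶜ := by
    rintro _ ⟨⟨s, z⟩, ⟨hs, hz⟩, rfl⟩ ⟨⟨t, y⟩, ⟨ht, hy⟩, hty⟩
    refine hchord (-s + t) ?_ y hy ?_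
    · rw [abs_le]
      constructor <;> linarith [hs.1, hs.2, ht.1, ht.2]
    · have : φ t y = φ s z := hty
      rw [hφ.add hv, this, ← hφ.add hv, neg_add_cancel, hφ.zero]
      exact hz
  obtain ⟨w, hw, hwc, hw1, hw0, hw01⟩ := exists_contMDiff_cutoff I (hA K₁ hK₁)
    (hA K₀ hK₀).isClosed.isOpen_compl hdisj
  let w' : N → ℝ := fun x ↦ mvfderiv I w x (v x)
  have hw' : ContMDiff I 𝓘(ℝ, ℝ) ∞ w' := contMDiff_mvfderiv_apply hv hw
  let w'' : N → ℝ := fun x ↦ mvfderiv I w' x (v x)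
  have hw'' : ContMDiff I 𝓘(ℝ, ℝ) ∞ w'' := contMDiff_mvfderiv_apply hv hw'
  obtain ⟨C, hC⟩ := hw''.continuous.bounded_above_of_compact_support
    (hasCompactSupport_mvfderiv_apply (hasCompactSupport_mvfderiv_apply hwc))
  obtain ⟨n, hn⟩ : ∃ n : ℕ, C * T / (b - 1 / T) < n := exists_nat_gt _
  obtain ⟨n, hn0, hn⟩ : ∃ n : ℕ, n ≠ 0 ∧ C * T / (b - 1 / T) < n :=
    ⟨n + 1, n.succ_ne_zero, hn.trans (by push_cast; linarith)⟩
  have hnpos : (0 : ℝ) < n := by positivity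
  set h : ℝ := T / n with hh
  have hhpos : 0 < h := by positivity
  have hkT : ∀ k ∈ Finset.range n, (k * h : ℝ) ∈ Icc 0 T := by
    intro k hk
    refine ⟨by positivity, ?_⟩
    have : (k : ℝ) ≤ n := by exact_mod_cast (Finset.mem_range.1 hk).le
    calc (k : ℝ) * h ≤ n * h := by gcongr
      _ = T := by rw [hh]; field_simp
  let U : N → ℝ := fun z ↦ (n : ℝ)⁻¹ * ∑ k ∈ Finset.range n, w (φ (k * h) z)
  have hU : ContMDiff I 𝓘(ℝ, ℝ) ∞ U :=
    contMDiff_const.mul (contMDiff_finsetSum fun k _ ↦ hw.comp (hφ.contMDiff hv _))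
  refine ⟨U, hU, ?_, fun z hz ↦ ?_, fun z hz ↦ ?_, fun z ↦ ?_⟩
  · refine HasCompactSupport.intro (K := (fun q : ℝ × N ↦ φ q.1 q.2) '' (Icc (-T) 0 ×ˢ tsupport w))
      ((isCompact_Icc.prod hwc).image hcont) fun z hz ↦ ?_
    have : ∑ k ∈ Finset.range n, w (φ (k * h) z) = 0 := Finset.sum_eq_zero fun k hk ↦ by
      by_contra hne
      refine hz ⟨(-(k * h), φ (k * h) z), ⟨⟨?_, ?_⟩, subset_tsupport _ hne⟩, ?_⟩
      · simpa using (hkT k hk).2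
      · simpa using (hkT k hk).1
      · change φ (-(k * h)) (φ (k * h) z) = z
        rw [← hφ.add hv, neg_add_cancel, hφ.zero]
    change (n : ℝ)⁻¹ * ∑ k ∈ Finset.range n, w (φ (k * h) z) = 0
    rw [this, mul_zero]
  · change (n : ℝ)⁻¹ * ∑ k ∈ Finset.range n, w (φ (k * h) z) = 0
    rw [Finset.sum_eq_zero fun (k : ℕ) hk ↦ hw0 _ (fun hc ↦ hc
      ⟨((k * h : ℝ), z), ⟨hkT k hk, hz⟩, rfl⟩),
      mul_zero]
  · change (n : ℝ)⁻¹ * ∑ k ∈ Finset.range n, w (φ (k * h) z) = 1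
    rw [Finset.sum_congr rfl fun (k : ℕ) hk ↦
      hw1.self_of_nhdsSet (φ (k * h) z) ⟨((k * h : ℝ), z), ⟨hkT k hk, hz⟩, rfl⟩]
    simp [hnpos.ne']
  · -- The derivative of `U` along `v` is the mean of `w'` at the points `φ (k * h) z`.
    have hd1 := hasDerivAt_comp_integralCurve (hφ.curve z) hU 0
    have hd2 : HasDerivAt (fun s ↦ U (φ s z))
        ((n : ℝ)⁻¹ * ∑ k ∈ Finset.range n, w' (φ (k * h) z)) 0 := by
      refine HasDerivAt.const_mul _ (HasDerivAt.fun_sum fun k _ ↦ ?_)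
      have h3 := hasDerivAt_comp_integralCurve (hφ.curve z) hw (k * h)
      have h4 : HasDerivAt (fun s ↦ w (φ (s + k * h) z)) (w' (φ (k * h) z)) 0 :=
        HasDerivAt.comp_add_const (0 : ℝ) (k * h) (by rw [zero_add]; exact h3)
      refine h4.congr_of_eventuallyEq (Filter.Eventually.of_forall fun s ↦ ?_)
      beta_reduce
      rw [← hφ.add hv, add_comm]
    have heq := hd1.unique hd2
    rw [hφ.zero] at heq
    rw [heq]
    refine (abs_average_deriv_le (g := fun t ↦ w (φ t z)) (g' := fun t ↦ w' (φ t z))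
      (g'' := fun t ↦ w'' (φ t z)) (hasDerivAt_comp_integralCurve (hφ.curve z) hw)
      (hasDerivAt_comp_integralCurve (hφ.curve z) hw') (fun t ↦ hC _) (fun t ↦ hw01 _)
      hhpos hn0).trans ?_
    have h5 : n * h = T := by rw [hh]; field_simp
    have h6 : C * h ≤ b - 1 / T := by
      rw [div_lt_iff₀ (by linarith)] at hn
      rw [hh, mul_div_assoc', div_le_iff₀ hnpos]
      linarith
    rw [h5]
    linarith

end Averaging

/-! ### Smoothness of Hamiltonian vector fields -/

section Hamiltonian

open Set Bundle

variable {E : Type*} [NormedAddCommGroup E] [NormedSpace ℝ E]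
  {H : Type*} [TopologicalSpace H] {I : ModelWithCorners ℝ E H}
  {M : Type*} [TopologicalSpace M] [ChartedSpace H M]
  {E' : Type*} [NormedAddCommGroup E'] [NormedSpace ℝ E']
  {H' : Type*} [TopologicalSpace H'] {I' : ModelWithCorners ℝ E' H'}
  {P : Type*} [TopologicalSpace P] [ChartedSpace H' P] [IsManifold I' ∞ P]

/-- Over a finite dimensional space, a nondegenerate bilinear form is an isomorphism onto the
dual space. -/
theorem isInvertible_of_nondegenerate [FiniteDimensional ℝ E] (A : E →L[ℝ] E →L[ℝ] ℝ)
    (hA : ∀ v, (∀ w, A v w = 0) → v = 0) : A.IsInvertible := by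
  have hinj : LinearMap.ker (A : E →ₗ[ℝ] E →L[ℝ] ℝ) = ⊥ := by
    rw [LinearMap.ker_eq_bot']
    intro m hm
    exact hA m fun w ↦ by simpa using congrArg (fun f : E →L[ℝ] ℝ ↦ f w) hm
  have hfr : Module.finrank ℝ E = Module.finrank ℝ (E →L[ℝ] ℝ) :=
    (Subspace.dual_finrank_eq (K := ℝ) (V := E)).symm.trans
      (LinearMap.toContinuousLinearMap (𝕜 := ℝ) (E := E) (F' := ℝ)).finrank_eq
  exact ⟨(LinearEquiv.ofInjectiveOfFinrankEq (A : E →ₗ[ℝ] E →L[ℝ] ℝ)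
    (LinearMap.ker_eq_bot.mp hinj) hfr).toContinuousLinearEquiv, by ext; rfl⟩

/-- A smooth field of bilinear forms has smooth coefficients in the trivializations of the tangent
bundle. -/
theorem exists_contMDiffAt_bilinField_coordinates [IsManifold I ∞ M] (Ω : BilinField I M)
    (hΩ : ContMDiff I (I.prod 𝓘(ℝ, E →L[ℝ] E →L[ℝ] ℝ)) ∞
      (fun x ↦ Bundle.TotalSpace.mk' (E →L[ℝ] E →L[ℝ] ℝ)
        (E := fun x : M ↦ TangentSpace I x →L[ℝ] TangentSpace I x →L[ℝ] ℝ) x (Ω x))) (x₀ : M) :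
    ∃ A : M → E →L[ℝ] E →L[ℝ] ℝ, ContMDiffAt I 𝓘(ℝ, E →L[ℝ] E →L[ℝ] ℝ) ∞ A x₀ ∧
      ∀ x ∈ (trivializationAt E (TangentSpace I) x₀).baseSet, ∀ u w : E,
        A x u w = Ω x ((trivializationAt E (TangentSpace I) x₀).symm x u)
          ((trivializationAt E (TangentSpace I) x₀).symm x w) := by
  refine ⟨_, ((contMDiffAt_hom_bundle _).1 (hΩ x₀)).2, fun x hx u w ↦ ?_⟩
  refine (inCoordinates_apply_eq₂ (F₁ := E) (E₁ := TangentSpace I) (F₂ := E)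
    (E₂ := TangentSpace I) (F₃ := ℝ) (E₃ := Bundle.Trivial M ℝ) (x₀ := x₀) (x := x) (ϕ := Ω x)
    (v := u) (w := w) hx hx (mem_univ _)).trans ?_
  exact DFunLike.congr_fun
    (Bundle.Trivial.linearMapAt_trivialization (𝕜 := ℝ) (B := M) (F := ℝ) x) _

/-- The partial differential of a smooth function has smooth coefficients in the trivializations
of the tangent bundle. -/
theorem exists_contMDiffAt_mvfderiv_coordinates [IsManifold I ∞ M] (G : M × P → ℝ)
    (hG : ContMDiff (I.prod I') 𝓘(ℝ, ℝ) ∞ G) (q₀ : M × P) :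
    ∃ l : M × P → E →L[ℝ] ℝ, ContMDiffAt (I.prod I') 𝓘(ℝ, E →L[ℝ] ℝ) ∞ l q₀ ∧
      ∀ q, q.1 ∈ (trivializationAt E (TangentSpace I) q₀.1).baseSet →
        ∀ w : E, l q w = mvfderiv I (fun y ↦ G (y, q.2)) q.1
        ((trivializationAt E (TangentSpace I) q₀.1).symm q.1 w) := by
  have : IsManifold I 1 M := .of_le (n := ∞) (by simp)
  have : IsManifold I' 1 P := .of_le (n := ∞) (by simp)
  have hf : ContMDiffAt ((I.prod I').prod I) 𝓘(ℝ, ℝ) ∞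
      (Function.uncurry fun (q : M × P) (y : M) ↦ G (y, q.2)) (q₀, q₀.1) :=
    (hG.comp (contMDiff_snd.prodMk (contMDiff_snd.comp contMDiff_fst))).contMDiffAt
  have h := ContMDiffAt.mfderiv (m := ∞) (fun (q : M × P) (y : M) ↦ G (y, q.2)) Prod.fst hf
    contMDiffAt_fst (by simp)
  refine ⟨_, h, fun q hq w ↦ ?_⟩
  simp only [inTangentCoordinates, ContinuousLinearMap.inCoordinates]
  rw [TangentBundle.continuousLinearMapAt_model_space]
  change mfderiv I 𝓘(ℝ, ℝ) (fun y ↦ G (y, q.2)) q.1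
    ((trivializationAt E (TangentSpace I) q₀.1).symmL ℝ q.1 w) = _
  rw [Trivialization.symmL_apply _ hq]
  rfl

/-- The Hamiltonian vector field of a smooth function depends smoothly on the point and on the
parameters of the function. In local coordinates it is the solution of a linear system with
smooth invertible matrix. -/
theorem IsSymplecticForm.contMDiff_sgrad [FiniteDimensional ℝ E] [IsManifold I ∞ M]
    {Ω : BilinField I M} (hΩ : IsSymplecticForm Ω) {G : M × P → ℝ}
    (hG : ContMDiff (I.prod I') 𝓘(ℝ, ℝ) ∞ G) :
    ContMDiff (I.prod I') I.tangent ∞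
      (fun q : M × P ↦ (⟨q.1, sgrad Ω (fun y ↦ G (y, q.2)) q.1⟩ : TangentBundle I M)) := by
  intro q₀
  rw [contMDiffAt_totalSpace]
  refine ⟨contMDiffAt_fst, ?_⟩
  obtain ⟨A, hA, hAe⟩ := exists_contMDiffAt_bilinField_coordinates Ω hΩ.smooth q₀.1
  obtain ⟨l, hl, hle⟩ := exists_contMDiffAt_mvfderiv_coordinates G hG q₀
  let e := trivializationAt E (TangentSpace I) q₀.1
  have hinv : ∀ x ∈ e.baseSet, (A x).IsInvertible := fun x hx ↦ by
    refine isInvertible_of_nondegenerate _ fun v hv ↦ ?_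
    have h0 : e.symm x v = 0 := hΩ.nondegenerate x _ fun w ↦ by
      have := hv ((e.continuousLinearEquivAt ℝ x hx) w)
      rw [hAe x hx] at this
      convert this using 2
      exact ((e.continuousLinearEquivAt ℝ x hx).symm_apply_apply w).symm
    have h1 := (e.continuousLinearEquivAt ℝ x hx).apply_symm_apply v
    rw [← h1]
    change (e.continuousLinearEquivAt ℝ x hx) (e.symm x v) = 0
    rw [h0, map_zero]
  have hbase : q₀.1 ∈ e.baseSet := mem_baseSet_trivializationAt E (TangentSpace I) q₀.1
  have hAi : ContMDiffAt (I.prod I') 𝓘(ℝ, (E →L[ℝ] ℝ) →L[ℝ] E) ∞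
      (fun q : M × P ↦ (A q.1).inverse) q₀ :=
    ((hinv _ hbase).contDiffAt_map_inverse (n := ∞)).contMDiffAt.comp q₀
      (hA.comp q₀ contMDiffAt_fst)
  refine ((hAi.clm_apply hl).neg).congr_of_eventuallyEq ?_
  have hev : ∀ᶠ q : M × P in 𝓝 q₀, q.1 ∈ e.baseSet :=
    continuousAt_fst.eventually_mem (e.open_baseSet.mem_nhds hbase)
  filter_upwards [hev] with q hq
  let eq := e.continuousLinearEquivAt ℝ q.1 hq
  let a := sgrad Ω (fun y ↦ G (y, q.2)) q.1
  have ha : ∀ w, Ω q.1 a w = -mvfderiv I (fun y ↦ G (y, q.2)) q.1 w :=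
    (eq_sgrad_iff Ω _ q.1 (hΩ.nondegenerate q.1) a).1 rfl
  change eq a = -(A q.1).inverse (l q)
  have hAa : A q.1 (eq a) = -l q := by
    ext w
    change A q.1 (eq a) w = -(l q w)
    rw [hAe q.1 hq, hle q hq, ← ha]
    congr 2
    exact eq.symm_apply_apply a
  rw [← map_neg, ← hAa]
  obtain ⟨B, hB⟩ := hinv q.1 hq
  rw [← hB, ContinuousLinearMap.inverse_equiv]
  exact (B.symm_apply_apply _).symm

end Hamiltonian

/-! ### The rotation field of the circle -/

section CircleField

open Set Bundle

theorem contMDiff_circlePt : ContMDiff 𝓘(ℝ, ℝ) (𝓡 1) ∞ circlePt :=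
  contMDiff_circleExp.comp (contMDiff_const.mul contMDiff_id :
    ContMDiff 𝓘(ℝ, ℝ) 𝓘(ℝ, ℝ) ∞ fun θ : ℝ ↦ 2 * Real.pi * θ)

theorem circlePt_zero : circlePt 0 = 1 := by simp [circlePt]

theorem circlePt_add (s t : ℝ) : circlePt (s + t) = circlePt s * circlePt t := by
  simp [circlePt, mul_add]

theorem circlePt_surjective : Function.Surjective circlePt := by
  intro z
  refine ⟨(2 * Real.pi)⁻¹ * Complex.arg z, ?_⟩
  rw [circlePt, mul_inv_cancel_left₀ (by positivity), Circle.exp_arg]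

theorem coe_circlePt (s : ℝ) :
    (circlePt s : ℂ) = Complex.exp ((2 * Real.pi * Complex.I) * s) := by
  rw [circlePt, Circle.coe_exp]
  congr 1
  push_cast
  ring

/-- The unit rotation field `∂/∂θ` of the circle, the velocity of `s ↦ z · exp(2πis)` at
`s = 0`. -/
noncomputable def circleField (z : Circle) : TangentSpace (𝓡 1) z :=
  mfderiv 𝓘(ℝ, ℝ) (𝓡 1) (fun s ↦ z * circlePt s) 0 (1 : ℝ)

theorem contMDiff_mul_circlePt :
    ContMDiff ((𝓡 1).prod 𝓘(ℝ, ℝ)) (𝓡 1) ∞ (fun q : Circle × ℝ ↦ q.1 * circlePt q.2) :=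
  (contMDiff_fst (I := 𝓡 1) (J := 𝓘(ℝ, ℝ))).mul (contMDiff_circlePt.comp contMDiff_snd)

theorem contMDiff_rotation (z : Circle) :
    ContMDiff 𝓘(ℝ, ℝ) (𝓡 1) ∞ (fun s ↦ z * circlePt s) :=
  contMDiff_mul_circlePt.comp (contMDiff_const.prodMk contMDiff_id)

theorem hasMFDerivAt_rotation (z : Circle) (t : ℝ) :
    HasMFDerivAt 𝓘(ℝ, ℝ) (𝓡 1) (fun s ↦ z * circlePt s) t
      ((1 : ℝ →L[ℝ] ℝ).smulRight (circleField (z * circlePt t))) := by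
  have h0 : ∀ w, HasMFDerivAt 𝓘(ℝ, ℝ) (𝓡 1) (fun s ↦ w * circlePt s) 0
      ((1 : ℝ →L[ℝ] ℝ).smulRight (circleField w)) := by
    intro w
    have h := ((contMDiff_rotation w).mdifferentiableAt (x := 0) (by simp)).hasMFDerivAt
    have h1 : (1 : ℝ →L[ℝ] ℝ).smulRight (circleField w) =
        mfderiv 𝓘(ℝ, ℝ) (𝓡 1) (fun s ↦ w * circlePt s) 0 :=
      ContinuousLinearMap.ext_ring (by
        change (1 : ℝ) • mfderiv 𝓘(ℝ, ℝ) (𝓡 1) (fun s ↦ w * circlePt s) 0 (1 : ℝ) = _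
        rw [one_smul]
        rfl)
    rwa [← h1] at h
  have h2 : HasMFDerivAt 𝓘(ℝ, ℝ) 𝓘(ℝ, ℝ) (fun s : ℝ ↦ s - t) t (1 : ℝ →L[ℝ] ℝ) :=
    ((hasFDerivAt_id t).sub_const t).hasMFDerivAt
  have h1 : HasMFDerivAt 𝓘(ℝ, ℝ) (𝓡 1) (fun s ↦ (z * circlePt t) * circlePt s) (t - t)
      ((1 : ℝ →L[ℝ] ℝ).smulRight (circleField (z * circlePt t))) := by
    rw [sub_self]
    exact h0 _
  have h3 := HasMFDerivAt.comp (f := fun s : ℝ ↦ s - t) t h1 h2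
  refine (h3.congr_of_eventuallyEq (Filter.Eventually.of_forall fun s ↦ ?_))
  simp only [Function.comp_apply]
  rw [mul_assoc, ← circlePt_add, add_sub_cancel]

theorem contMDiff_circleField :
    ContMDiff (𝓡 1) (𝓡 1).tangent ∞
      (fun z ↦ (⟨z, circleField z⟩ : TangentBundle (𝓡 1) Circle)) := by
  have h1 : ContMDiff (𝓡 1) (((𝓡 1).prod 𝓘(ℝ, ℝ)).tangent) ∞ (fun z : Circle ↦
      (equivTangentBundleProd (𝓡 1) Circle 𝓘(ℝ, ℝ) ℝ).symm
        ((⟨z, 0⟩ : TangentBundle (𝓡 1) Circle), (⟨0, (1 : ℝ)⟩ : TangentBundle 𝓘(ℝ, ℝ) ℝ))) :=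
    contMDiff_equivTangentBundleProd_symm.comp
      ((contMDiff_zeroSection ℝ _).prodMk contMDiff_const)
  have h2 := (contMDiff_mul_circlePt.contMDiff_tangentMap (m := ∞) (by simp)).comp h1
  refine h2.congr fun z ↦ ?_
  have h3 := mfderiv_prod_eq_add_apply (p := ((z, 0) : Circle × ℝ))
    (v := ((0 : EuclideanSpace ℝ (Fin 1)), (1 : ℝ)))
    (contMDiff_mul_circlePt.mdifferentiableAt (x := ((z, 0) : Circle × ℝ)) (by simp))
  have hmk : ∀ (a b : Circle) (u w : EuclideanSpace ℝ (Fin 1)), a = b → u = w →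
      (⟨a, u⟩ : TangentBundle (𝓡 1) Circle) = ⟨b, w⟩ := by
    rintro a _ u _ rfl rfl
    rfl
  refine hmk _ _ _ _ ?_ ?_
  · change z = z * circlePt 0
    rw [circlePt_zero, mul_one]
  · refine Eq.trans ?_ h3.symm
    exact (zero_add (circleField z)).symm.trans
      (congrArg₂ (· + ·) (ContinuousLinearMap.map_zero (mfderiv (𝓡 1) (𝓡 1)
        (fun w : Circle ↦ w * circlePt 0) z)).symm rfl)

/-- The one-form `dθ` takes the value `1` on the rotation field. -/
theorem dTheta_circleField (z : Circle) : dTheta z (circleField z) = 1 := by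
  have : Fact (Module.finrank ℝ ℂ = 1 + 1) := finrank_real_complex_fact'
  have h1 : MDifferentiableAt (𝓡 1) 𝓘(ℝ, ℂ) (fun w : Circle ↦ (w : ℂ)) (z * circlePt 0) :=
    (contMDiff_coe_sphere (n := 1) (m := 1)).mdifferentiableAt one_ne_zero
  have h2 := HasMFDerivAt.comp (0 : ℝ) h1.hasMFDerivAt (hasMFDerivAt_rotation z 0)
  rw [circlePt_zero, mul_one] at h2
  have h3 : HasDerivAt (fun s : ℝ ↦ (z : ℂ) * Complex.exp ((2 * Real.pi * Complex.I) * s))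
      (z * (2 * Real.pi * Complex.I)) 0 := by
    have h4 := (((hasDerivAt_id (0 : ℝ)).ofReal_comp.const_mul
      (2 * Real.pi * Complex.I)).cexp).const_mul (z : ℂ)
    simpa using h4
  have h5 : (fun w : Circle ↦ (w : ℂ)) ∘ (fun s ↦ z * circlePt s) =
      fun s : ℝ ↦ (z : ℂ) * Complex.exp ((2 * Real.pi * Complex.I) * s) := by
    ext s
    simp [coe_circlePt]
  rw [h5] at h2
  have h6 := hasMFDerivAt_unique h2 h3.hasFDerivAt.hasMFDerivAt
  have h7 : mfderiv (𝓡 1) 𝓘(ℝ, ℂ) (fun w : Circle ↦ (w : ℂ)) z (circleField z) =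
      (z * (2 * Real.pi * Complex.I) : ℂ) := by
    have h8 := DFunLike.congr_fun h6 (1 : ℝ)
    change mfderiv (𝓡 1) 𝓘(ℝ, ℂ) (fun w : Circle ↦ (w : ℂ)) z ((1 : ℝ) • circleField z) =
      (1 : ℝ) • (z * (2 * Real.pi * Complex.I) : ℂ) at h8
    rwa [one_smul, one_smul] at h8
  have h9 : dTheta z (circleField z) = (2 * Real.pi)⁻¹ *
      (starRingEnd ℂ (z : ℂ) * (z * (2 * Real.pi * Complex.I))).im := by
    rw [← h7]
    rfl
  rw [h9, ← mul_assoc, ← Complex.normSq_eq_conj_mul_self, Circle.normSq_coe]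
  have hπ := Real.pi_pos.ne'
  simp
  field_simp

theorem eq_dTheta_smul_circleField (z : Circle) (v : TangentSpace (𝓡 1) z) :
    v = dTheta z v • circleField z := by
  have h0 : circleField z ≠ 0 := by
    intro h
    have := dTheta_circleField z
    rw [h, map_zero] at this
    exact zero_ne_one this
  have hfr : Module.finrank ℝ (TangentSpace (𝓡 1) z) = 1 :=
    finrank_euclideanSpace_fin (𝕜 := ℝ) (n := 1)
  obtain ⟨c, hc⟩ := (finrank_eq_one_iff_of_nonzero' _ h0).1 hfr v
  rw [← hc, map_smul, dTheta_circleField, smul_eq_mul, mul_one]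

end CircleField

/-! ### The suspension of a time-periodic Hamiltonian -/

section Suspension

open Set Bundle

universe u

variable {E : Type u} [NormedAddCommGroup E] [NormedSpace ℝ E]
  {H : Type*} [TopologicalSpace H] {I : ModelWithCorners ℝ E H}
  {M : Type*} [TopologicalSpace M] [ChartedSpace H M]

/-- The suspension of the time-dependent Hamiltonian vector field of `G`: the autonomous field
`sgrad G_θ + ∂/∂θ` on `M × S¹`. -/
noncomputable def suspensionField (Ω : BilinField I M) (G : M × Circle → ℝ) (q : M × Circle) :
    TangentSpace (I.prod (𝓡 1)) q :=
  ((sgrad Ω (fun y ↦ G (y, q.2)) q.1 : E), (circleField q.2 : EuclideanSpace ℝ (Fin 1)))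

theorem contMDiff_suspensionField [FiniteDimensional ℝ E] [IsManifold I ∞ M]
    {Ω : BilinField I M} (hΩ : IsSymplecticForm Ω) {G : M × Circle → ℝ}
    (hG : ContMDiff (I.prod (𝓡 1)) 𝓘(ℝ, ℝ) ∞ G) :
    ContMDiff (I.prod (𝓡 1)) (I.prod (𝓡 1)).tangent ∞
      (fun q ↦ (⟨q, suspensionField Ω G q⟩ : TangentBundle (I.prod (𝓡 1)) (M × Circle))) := by
  have : IsManifold I 1 M := .of_le (n := ∞) (by simp)
  have : IsManifold (𝓡 1) ∞ Circle := .of_le (n := ω) le_top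
  have : IsManifold (𝓡 1) 1 Circle := .of_le (n := ω) le_top
  exact contMDiff_equivTangentBundleProd_symm.comp
    ((hΩ.contMDiff_sgrad hG).prodMk (contMDiff_circleField.comp contMDiff_snd))

/-- The curve `(y(t), z · exp(2πit))` is an integral curve of the suspension exactly when `y` solves
Hamilton's equation. -/
theorem hasMFDerivAt_suspension_iff {Ω : BilinField I M} {G : M × Circle → ℝ} {y : ℝ → M}
    {z : Circle} {t : ℝ} :
    HasMFDerivAt 𝓘(ℝ, ℝ) (I.prod (𝓡 1)) (fun s ↦ (y s, z * circlePt s)) t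
      ((1 : ℝ →L[ℝ] ℝ).smulRight (suspensionField Ω G (y t, z * circlePt t))) ↔
    HasMFDerivAt 𝓘(ℝ, ℝ) I y t
      ((1 : ℝ →L[ℝ] ℝ).smulRight (sgrad Ω (fun x ↦ G (x, z * circlePt t)) (y t))) := by
  constructor
  · intro h
    exact (hasMFDerivAt_fst (I := I) (I' := 𝓡 1) (x := (y t, z * circlePt t))).comp t h
  · intro h
    exact h.prodMk (hasMFDerivAt_rotation z t)

theorem sgrad_eq_zero_of_notMem_tsupport {Ω : BilinField I M} {F : M → ℝ} {x : M}
    (hx : x ∉ tsupport F) : sgrad Ω F x = 0 := by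
  rw [sgrad, mvfderiv_eq_zero_of_notMem_tsupport hx, map_zero, neg_zero]

/-- The suspension of a compactly supported periodic Hamiltonian is complete. -/
theorem exists_isGlobalFlow_suspensionField [FiniteDimensional ℝ E] [IsManifold I ∞ M]
    [I.Boundaryless] [T2Space M] {Ω : BilinField I M} (hΩ : IsSymplecticForm Ω)
    {G : M × Circle → ℝ} (hG : SmoothCompactlySupported (I.prod (𝓡 1)) G) :
    ∃ φ : ℝ → M × Circle → M × Circle, IsGlobalFlow (suspensionField Ω G) φ := by
  have : IsManifold (𝓡 1) ∞ Circle := .of_le (n := ω) le_top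
  have hK : IsCompact (Prod.fst '' tsupport G) := IsCompact.image hG.2 continuous_fst
  refine exists_isGlobalFlow_of_isCompact (contMDiff_suspensionField hΩ hG.1)
    (hK.prod (isCompact_univ (X := Circle))) fun q hq ↦ ?_
  have hq1 : q.1 ∉ Prod.fst '' tsupport G := fun h ↦ hq ⟨h, mem_univ _⟩
  refine ⟨fun s ↦ (q.1, q.2 * circlePt s), by simp [circlePt_zero], fun t ↦ ?_⟩
  refine hasMFDerivAt_suspension_iff.2 ?_
  have hz : sgrad Ω (fun x ↦ G (x, q.2 * circlePt t)) q.1 = 0 := by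
    refine sgrad_eq_zero_of_notMem_tsupport fun h ↦ hq1 ?_
    have hsub : tsupport (fun x ↦ G (x, q.2 * circlePt t)) ⊆ Prod.fst '' tsupport G :=
      closure_minimal (fun x hx ↦ ⟨(x, q.2 * circlePt t), subset_tsupport _ hx, rfl⟩)
        hK.isClosed
    exact hsub h
  have h0 : (1 : ℝ →L[ℝ] ℝ).smulRight (0 : TangentSpace I q.1) = 0 :=
    ContinuousLinearMap.ext fun s ↦ smul_zero (A := TangentSpace I q.1) s
  rw [hz, h0]
  exact hasMFDerivAt_const q.1 t

/-- The circle component of the suspension flow is a rotation with constant speed. -/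
theorem IsGlobalFlow.suspension_snd {Ω : BilinField I M} {G : M × Circle → ℝ}
    {φ : ℝ → M × Circle → M × Circle} (hφ : IsGlobalFlow (suspensionField Ω G) φ)
    (t : ℝ) (q : M × Circle) : (φ t q).2 = q.2 * circlePt t := by
  have : IsManifold (𝓡 1) 1 Circle := .of_le (n := ω) le_top
  have h1 : IsMIntegralCurve (fun t ↦ (φ t q).2) circleField := fun t ↦
    (hasMFDerivAt_snd (I := I) (I' := 𝓡 1) (x := φ t q)).comp t (hφ.curve q t)
  have h2 : IsMIntegralCurve (fun t ↦ q.2 * circlePt t) circleField := hasMFDerivAt_rotation q.2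
  exact congrFun (isMIntegralCurve_Ioo_eq_of_contMDiff_boundaryless (t₀ := 0)
    (contMDiff_circleField.of_le (by simp)) h1 h2 (by simp [hφ.zero, circlePt_zero])) t

/-- The suspension flow, started at time `0`, gives the Hamiltonian flow of `G`. -/
theorem IsGlobalFlow.isHamiltonianFlow {Ω : BilinField I M} {G : M × Circle → ℝ}
    {φ : ℝ → M × Circle → M × Circle} (hφ : IsGlobalFlow (suspensionField Ω G) φ) :
    IsHamiltonianFlow Ω G (fun t x ↦ (φ t (x, 1)).1) := by
  refine ⟨fun x ↦ congrArg Prod.fst (hφ.zero (x, 1)), fun x t ↦ ?_⟩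
  have h := hφ.curve (x, 1) t
  have h1 : (fun t ↦ φ t (x, 1)) = fun s ↦ ((φ s (x, 1)).1, 1 * circlePt s) := by
    ext s : 1
    rw [← hφ.suspension_snd s (x, 1)]
  rw [h1] at h
  have h2 := hasMFDerivAt_suspension_iff.1 h
  simpa only [one_mul] using h2

/-- Every orbit of the suspension is given by the Hamiltonian flow, after a shift of time. -/
theorem IsGlobalFlow.exists_hamiltonian_orbit [FiniteDimensional ℝ E] [IsManifold I ∞ M]
    [I.Boundaryless] [T2Space M] {Ω : BilinField I M} (hΩ : IsSymplecticForm Ω)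
    {G : M × Circle → ℝ} (hG : ContMDiff (I.prod (𝓡 1)) 𝓘(ℝ, ℝ) ∞ G)
    {φ : ℝ → M × Circle → M × Circle} (hφ : IsGlobalFlow (suspensionField Ω G) φ)
    {g : ℝ → M → M} (hg : IsHamiltonianFlow Ω G g) (q : M × Circle) :
    ∃ (x : M) (t₀ : ℝ), ∀ t, (φ t q).1 = g (t₀ + t) x := by
  have : IsManifold (𝓡 1) ∞ Circle := .of_le (n := ω) le_top
  have hv := contMDiff_suspensionField hΩ hG
  obtain ⟨t₀, ht₀⟩ := circlePt_surjective q.2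
  refine ⟨(φ (-t₀) q).1, t₀, fun t ↦ ?_⟩
  set x := (φ (-t₀) q).1 with hx
  have hx1 : φ (-t₀) q = (x, 1) := by
    refine Prod.ext rfl ?_
    rw [hφ.suspension_snd, ← ht₀, ← circlePt_add, add_neg_cancel, circlePt_zero]
  have hcurve : IsMIntegralCurve (fun t ↦ (g t x, (1 : Circle) * circlePt t))
      (suspensionField Ω G) := fun t ↦ hasMFDerivAt_suspension_iff.2 (by
    simpa only [one_mul] using hg.2 x t)
  have h := hφ.eq_of_isMIntegralCurve hv hcurve (s := 0) (t₀ + t)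
  rw [circlePt_zero, mul_one, hg.1, add_zero, ← hx1, ← hφ.add hv] at h
  rw [show t₀ + t + -t₀ = t by ring] at h
  rw [h]

end Suspension

/-! ### The stabilized symplectic form -/

section Stabilization

open Set

/-- The inclusion of an open submanifold has the identity as derivative, since the charts of the
submanifold are restrictions of the charts of the manifold. -/
theorem hasMFDerivAt_opens_val {E : Type*} [NormedAddCommGroup E] [NormedSpace ℝ E]
    {H : Type*} [TopologicalSpace H] {I : ModelWithCorners ℝ E H}
    {N : Type*} [TopologicalSpace N] [ChartedSpace H N] (U : TopologicalSpace.Opens N) (x : U) :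
    HasMFDerivAt I I (Subtype.val : U → N) x (ContinuousLinearMap.id ℝ E) := by
  refine ⟨continuous_subtype_val.continuousAt, ?_⟩
  have h1 := TopologicalSpace.Opens.chartAt_subtype_val_symm_eventuallyEq (H := H) U (x := x)
  have hx : chartAt H x x = chartAt H (x : N) x := rfl
  have h2 : writtenInExtChartAt I I x (Subtype.val : U → N) =ᶠ[𝓝[range I] (extChartAt I x x)]
      id := by
    have h3 : ∀ᶠ z in 𝓝 (extChartAt I x x), (chartAt H (x : N)).symm (I.symm z) =
        ((chartAt H x).symm (I.symm z) : U) ∧ I.symm z ∈ (chartAt H (x : N)).target := by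
      have hc : Filter.Tendsto I.symm (𝓝 (extChartAt I x x)) (𝓝 (chartAt H (x : N) x)) := by
        have := I.continuous_symm.continuousAt (x := extChartAt I x x)
        rw [ContinuousAt] at this
        convert this using 2
        simp [extChartAt, hx]
      exact (hc.eventually h1).and (hc.eventually
        ((chartAt H (x : N)).open_target.mem_nhds ((chartAt H (x : N)).map_source
          (mem_chart_source H _))))
    filter_upwards [nhdsWithin_le_nhds h3, self_mem_nhdsWithin] with z hz hzr
    simp only [writtenInExtChartAt, extChartAt, mfld_simps, id]
    rw [← hz.1, (chartAt H (x : N)).right_inv hz.2, I.right_inv hzr]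
  exact (hasFDerivWithinAt_id _ _).congr_of_eventuallyEq h2
    (h2.self_of_nhdsWithin (by simp [extChartAt]))

variable {E : Type*} [NormedAddCommGroup E] [NormedSpace ℝ E]
  {H : Type*} [TopologicalSpace H] {I : ModelWithCorners ℝ E H}
  {M : Type*} [TopologicalSpace M] [ChartedSpace H M]

/-- The stabilized form in terms of the components of tangent vectors. -/
theorem prod_annulusForm_apply (Ω : BilinField I M) (R : EReal) (q : M × annulus R)
    (v w : E × (ℝ × EuclideanSpace ℝ (Fin 1))) :
    (Ω.prod (annulusForm R)) q v w = Ω q.1 v.1 w.1 +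
      (v.2.1 * dTheta (q.2 : ℝ × Circle).2 w.2.2 -
        dTheta (q.2 : ℝ × Circle).2 v.2.2 * w.2.1) := by
  simp only [BilinField.prod, BilinField.pullback, annulusForm, mfderiv_fst, mfderiv_snd,
    (hasMFDerivAt_opens_val (I := cylModel) (annulus R) q.2).mfderiv, cylForm, cylDTheta]
  have hr : cylDr (q.2 : ℝ × Circle) = ContinuousLinearMap.fst ℝ ℝ (EuclideanSpace ℝ (Fin 1)) := by
    rw [cylDr, mvfderiv, mfderiv_fst]
    rfl
  rw [hr]
  rfl

variable (Ω : BilinField I M) (R : EReal) (G : M × Circle → ℝ)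

/-- The projection `M × 𝔸_R → M × S¹`. -/
def baseProj (q : M × annulus R) : M × Circle := (q.1, (q.2 : ℝ × Circle).2)

/-- The function `r + G` on `M × 𝔸_R`, whose Hamiltonian flow covers the suspension flow
of `G`. -/
def suspensionHamiltonian (q : M × annulus R) : ℝ :=
  (q.2 : ℝ × Circle).1 + G (baseProj R q)

theorem contMDiff_annulus_val :
    ContMDiff cylModel cylModel ∞ (Subtype.val : annulus R → ℝ × Circle) :=
  contMDiff_subtype_val

theorem contMDiff_baseProj :
    ContMDiff (I.prod cylModel) (I.prod (𝓡 1)) ∞ (baseProj (M := M) R) :=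
  contMDiff_fst.prodMk (contMDiff_snd.comp ((contMDiff_annulus_val R).comp contMDiff_snd))

variable {G} in
theorem contMDiff_suspensionHamiltonian (hG : ContMDiff (I.prod (𝓡 1)) 𝓘(ℝ, ℝ) ∞ G) :
    ContMDiff (I.prod cylModel) 𝓘(ℝ, ℝ) ∞ (suspensionHamiltonian R G) :=
  (contMDiff_fst.comp ((contMDiff_annulus_val R).comp contMDiff_snd)).add
    (hG.comp (contMDiff_baseProj R))

theorem hasMFDerivAt_baseProj (q : M × annulus R) :
    HasMFDerivAt (I.prod cylModel) (I.prod (𝓡 1)) (baseProj R) q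
      ((ContinuousLinearMap.fst ℝ E (ℝ × EuclideanSpace ℝ (Fin 1))).prod
        ((ContinuousLinearMap.snd ℝ ℝ (EuclideanSpace ℝ (Fin 1))).comp
          (ContinuousLinearMap.snd ℝ E (ℝ × EuclideanSpace ℝ (Fin 1))))) := by
  have h1 : HasMFDerivAt (I.prod cylModel) cylModel
      (fun q : M × annulus R ↦ (q.2 : ℝ × Circle)) q _ :=
    (hasMFDerivAt_opens_val (I := cylModel) (annulus R) q.2).comp q (hasMFDerivAt_snd q)
  have h2 : HasMFDerivAt (I.prod cylModel) (𝓡 1)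
      (fun q : M × annulus R ↦ (q.2 : ℝ × Circle).2) q _ := (hasMFDerivAt_snd _).comp q h1
  exact (hasMFDerivAt_fst q).prodMk h2

theorem mvfderiv_comp_baseProj {U : M × Circle → ℝ} (q : M × annulus R)
    (hU : MDifferentiableAt (I.prod (𝓡 1)) 𝓘(ℝ, ℝ) U (baseProj R q))
    (w : E × (ℝ × EuclideanSpace ℝ (Fin 1))) :
    mvfderiv (I.prod cylModel) (fun q ↦ U (baseProj R q)) q w =
      mvfderiv (I.prod (𝓡 1)) U (baseProj R q) (w.1, w.2.2) := by
  have h := (hU.hasMFDerivAt.comp q (hasMFDerivAt_baseProj R q)).mfderiv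
  exact DFunLike.congr_fun h w

theorem mvfderiv_annulus_fst (q : M × annulus R) (w : E × (ℝ × EuclideanSpace ℝ (Fin 1))) :
    mvfderiv (I.prod cylModel) (fun q : M × annulus R ↦ (q.2 : ℝ × Circle).1) q w = w.2.1 := by
  have h1 : HasMFDerivAt (I.prod cylModel) cylModel
      (fun q : M × annulus R ↦ (q.2 : ℝ × Circle)) q _ :=
    (hasMFDerivAt_opens_val (I := cylModel) (annulus R) q.2).comp q (hasMFDerivAt_snd q)
  have h2 : HasMFDerivAt (I.prod cylModel) 𝓘(ℝ, ℝ)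
      (fun q : M × annulus R ↦ (q.2 : ℝ × Circle).1) q _ := (hasMFDerivAt_fst _).comp q h1
  exact DFunLike.congr_fun h2.mfderiv w

variable {G} in
theorem mvfderiv_suspensionHamiltonian (hG : ContMDiff (I.prod (𝓡 1)) 𝓘(ℝ, ℝ) ∞ G)
    (q : M × annulus R) (w : E × (ℝ × EuclideanSpace ℝ (Fin 1))) :
    mvfderiv (I.prod cylModel) (suspensionHamiltonian R G) q w =
      w.2.1 + mvfderiv (I.prod (𝓡 1)) G (baseProj R q) (w.1, w.2.2) := by
  have h1 : MDifferentiableAt (I.prod cylModel) 𝓘(ℝ, ℝ)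
      (fun q : M × annulus R ↦ (q.2 : ℝ × Circle).1) q :=
    (contMDiff_fst.comp ((contMDiff_annulus_val R).comp contMDiff_snd)).mdifferentiableAt
      (n := ∞) (by simp)
  have h2 : MDifferentiableAt (I.prod cylModel) 𝓘(ℝ, ℝ)
      (fun q : M × annulus R ↦ G (baseProj R q)) q :=
    (hG.comp (contMDiff_baseProj R)).mdifferentiableAt (by simp)
  have h3 := mvfderiv_add h1 h2
  rw [← mvfderiv_annulus_fst (I := I) R q w,
    ← mvfderiv_comp_baseProj R q (hG.mdifferentiableAt (by simp)) w]
  exact DFunLike.congr_fun h3 w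

variable {Ω} in
theorem nondegenerate_prod_annulusForm
    (hΩ : ∀ (x : M) (v : TangentSpace I x), (∀ w, Ω x v w = 0) → v = 0) (q : M × annulus R)
    (v : E × (ℝ × EuclideanSpace ℝ (Fin 1)))
    (h : ∀ w : E × (ℝ × EuclideanSpace ℝ (Fin 1)), (Ω.prod (annulusForm R)) q v w = 0) :
    v = 0 := by
  obtain ⟨v1, vr, vt⟩ := v
  let z := (q.2 : ℝ × Circle).2
  have hd0 : dTheta z (0 : EuclideanSpace ℝ (Fin 1)) = 0 := ContinuousLinearMap.map_zero _
  have hΩ0 : Ω q.1 v1 (0 : E) = 0 := ContinuousLinearMap.map_zero _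
  have h1 : v1 = 0 := hΩ q.1 v1 fun w ↦ by
    have hw := h (w, (0, 0))
    rw [prod_annulusForm_apply] at hw
    change Ω q.1 v1 w + (vr * dTheta z (0 : EuclideanSpace ℝ (Fin 1)) - dTheta z vt * 0) = 0 at hw
    rw [hd0] at hw
    linarith
  have h2 : dTheta z vt = 0 := by
    have hw := h (0, (1, 0))
    rw [prod_annulusForm_apply] at hw
    change Ω q.1 v1 (0 : E) +
      (vr * dTheta z (0 : EuclideanSpace ℝ (Fin 1)) - dTheta z vt * 1) = 0 at hw
    rw [hd0, hΩ0] at hw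
    linarith
  have h3 : vr = 0 := by
    have hw := h (0, (0, circleField z))
    rw [prod_annulusForm_apply] at hw
    change Ω q.1 v1 (0 : E) + (vr * dTheta z (circleField z) - dTheta z vt * 0) = 0 at hw
    rw [dTheta_circleField, hΩ0] at hw
    linarith
  have h4 : vt = 0 := by
    have := eq_dTheta_smul_circleField z vt
    rw [h2, zero_smul] at this
    exact this
  rw [h1, h3, h4]
  rfl

theorem mvfderiv_prod_left {U : M × Circle → ℝ} (q : M × Circle)
    (hU : MDifferentiableAt (I.prod (𝓡 1)) 𝓘(ℝ, ℝ) U q) (w : E) :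
    mvfderiv I (fun y ↦ U (y, q.2)) q.1 w =
      mvfderiv (I.prod (𝓡 1)) U q (w, (0 : EuclideanSpace ℝ (Fin 1))) := by
  have h1 : HasMFDerivAt I (I.prod (𝓡 1)) (fun y : M ↦ (y, q.2)) q.1 _ :=
    (hasMFDerivAt_id q.1).prodMk (hasMFDerivAt_const q.2 q.1)
  have h := (HasMFDerivAt.comp q.1 (g := U) hU.hasMFDerivAt h1).mfderiv
  exact DFunLike.congr_fun h w

variable {Ω G} in
/-- The Hamiltonian field of `r + G` projects to the suspension field of `G`, and `r + G` is
constant along it. -/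
theorem sgrad_suspensionHamiltonian [FiniteDimensional ℝ E] [IsManifold I ∞ M]
    (hΩ : IsSymplecticForm Ω) (hG : ContMDiff (I.prod (𝓡 1)) 𝓘(ℝ, ℝ) ∞ G)
    (q : M × annulus R) (v : E × (ℝ × EuclideanSpace ℝ (Fin 1)))
    (hv : v = sgrad (Ω.prod (annulusForm R)) (suspensionHamiltonian R G) q) :
    (v.1, v.2.2) = suspensionField Ω G (baseProj R q) ∧
      mvfderiv (I.prod cylModel) (suspensionHamiltonian R G) q v = 0 := by
  have key : ∀ w : E × (ℝ × EuclideanSpace ℝ (Fin 1)), (Ω.prod (annulusForm R)) q v w =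
      -mvfderiv (I.prod cylModel) (suspensionHamiltonian R G) q w :=
    (eq_sgrad_iff _ _ q (nondegenerate_prod_annulusForm R hΩ.nondegenerate q) v).1 hv
  obtain ⟨v1, vr, vt⟩ := v
  let z := (q.2 : ℝ × Circle).2
  have hd0 : dTheta z (0 : EuclideanSpace ℝ (Fin 1)) = 0 := ContinuousLinearMap.map_zero _
  have hΩ0 : Ω q.1 v1 (0 : E) = 0 := ContinuousLinearMap.map_zero _
  refine ⟨Prod.ext ?_ ?_, ?_⟩
  · refine (eq_sgrad_iff Ω (fun y ↦ G (y, z)) q.1 (hΩ.nondegenerate q.1) v1).2 fun w ↦ ?_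
    have h := key (w, (0, 0))
    rw [prod_annulusForm_apply, mvfderiv_suspensionHamiltonian R hG] at h
    change Ω q.1 v1 w + (vr * dTheta z (0 : EuclideanSpace ℝ (Fin 1)) - dTheta z vt * 0) =
      -(0 + mvfderiv (I.prod (𝓡 1)) G (baseProj R q) (w, (0 : EuclideanSpace ℝ (Fin 1)))) at h
    have h1 : mvfderiv I (fun y ↦ G (y, z)) q.1 w = _ :=
      mvfderiv_prod_left (baseProj R q) (hG.mdifferentiableAt (by simp)) w
    rw [hd0] at h
    linarith
  · have h := key (0, (1, 0))
    rw [prod_annulusForm_apply, mvfderiv_suspensionHamiltonian R hG] at h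
    have h0 : mvfderiv (I.prod (𝓡 1)) G (baseProj R q)
      ((0 : E), (0 : EuclideanSpace ℝ (Fin 1))) = 0 := ContinuousLinearMap.map_zero _
    change Ω q.1 v1 (0 : E) +
      (vr * dTheta z (0 : EuclideanSpace ℝ (Fin 1)) - dTheta z vt * 1) =
      -(1 + mvfderiv (I.prod (𝓡 1)) G (baseProj R q)
        ((0 : E), (0 : EuclideanSpace ℝ (Fin 1)))) at h
    have h2 : dTheta z vt = 1 := by
      rw [hd0, hΩ0, h0] at h
      linarith
    have := eq_dTheta_smul_circleField z vt
    rw [h2, one_smul] at this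
    exact this
  · have h := key (v1, (vr, vt))
    rw [prod_annulusForm_apply] at h
    have h0 : Ω q.1 v1 v1 = 0 := hΩ.alternating q.1 v1
    change Ω q.1 v1 v1 + (vr * dTheta z vt - dTheta z vt * vr) = _ at h
    linarith

variable {Ω G} in
/-- The bracket of a product `U κ(r + G)`, with `U` pulled back from `M × S¹`, and a function that
is locally `r + G` only sees the derivative of `U` along the suspension field. -/
theorem poissonBracket_mul_comp_suspensionHamiltonian [FiniteDimensional ℝ E] [IsManifold I ∞ M]
    (hΩ : IsSymplecticForm Ω) (hG : ContMDiff (I.prod (𝓡 1)) 𝓘(ℝ, ℝ) ∞ G)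
    {U : M × Circle → ℝ} (hU : ContMDiff (I.prod (𝓡 1)) 𝓘(ℝ, ℝ) ∞ U)
    {κ : ℝ → ℝ} (hκ : ContDiff ℝ ∞ κ) {K : M × annulus R → ℝ} (q : M × annulus R)
    (hK : K =ᶠ[𝓝 q] suspensionHamiltonian R G) :
    poissonBracket (Ω.prod (annulusForm R))
      (fun q ↦ U (baseProj R q) * κ (suspensionHamiltonian R G q)) K q =
      κ (suspensionHamiltonian R G q) *
        mvfderiv (I.prod (𝓡 1)) U (baseProj R q) (suspensionField Ω G (baseProj R q)) := by
  have hs : sgrad (Ω.prod (annulusForm R)) K q =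
      sgrad (Ω.prod (annulusForm R)) (suspensionHamiltonian R G) q := by
    have h : mvfderiv (I.prod cylModel) K q =
        mvfderiv (I.prod cylModel) (suspensionHamiltonian R G) q := by
      rw [mvfderiv, mvfderiv, hK.mfderiv_eq, hK.self_of_nhds]
    rw [sgrad, sgrad, h]
  rw [poissonBracket, hs]
  set v : E × (ℝ × EuclideanSpace ℝ (Fin 1)) :=
    sgrad (Ω.prod (annulusForm R)) (suspensionHamiltonian R G) q with hv
  obtain ⟨h1, h2⟩ := sgrad_suspensionHamiltonian R hΩ hG q v hv
  have hdU : MDifferentiableAt (I.prod cylModel) 𝓘(ℝ, ℝ) (fun q ↦ U (baseProj R q)) q :=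
    (hU.comp (contMDiff_baseProj R)).mdifferentiableAt (by simp)
  have hds : MDifferentiableAt (I.prod cylModel) 𝓘(ℝ, ℝ) (suspensionHamiltonian R G) q :=
    (contMDiff_suspensionHamiltonian R hG).mdifferentiableAt (by simp)
  have hdκ : MDifferentiableAt 𝓘(ℝ, ℝ) 𝓘(ℝ, ℝ) κ (suspensionHamiltonian R G q) :=
    (hκ.differentiable (by simp)).differentiableAt.mdifferentiableAt
  have h3 : mvfderiv (I.prod cylModel) (fun q ↦ κ (suspensionHamiltonian R G q)) q v = 0 := by
    have h := DFunLike.congr_fun (hdκ.hasMFDerivAt.comp q hds.hasMFDerivAt).mfderiv v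
    refine h.trans ?_
    change mfderiv 𝓘(ℝ, ℝ) 𝓘(ℝ, ℝ) κ (suspensionHamiltonian R G q)
      (mvfderiv (I.prod cylModel) (suspensionHamiltonian R G) q v) = 0
    rw [h2]
    exact ContinuousLinearMap.map_zero _
  have h4 := mvfderiv_comp_baseProj R q (hU.mdifferentiableAt (by simp)) v
  rw [h1] at h4
  have h5 := DFunLike.congr_fun (mvfderiv_mul hdU (hdκ.comp q hds)) v
  refine h5.trans ?_
  change U (baseProj R q) *
      mvfderiv (I.prod cylModel) (fun q ↦ κ (suspensionHamiltonian R G q)) q v +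
    κ (suspensionHamiltonian R G q) * mvfderiv (I.prod cylModel) (fun q ↦ U (baseProj R q)) q v = _
  rw [h3, h4, mul_zero, zero_add]

end Stabilization

/-! ### Upper bound for the stabilized Poisson bracket invariant -/

section UpperBound

open Set

universe u

/-- If no chord of length at most `ℓ` goes from `K₀` to `K₁`, then by compactness this remains true
for slightly longer chords. -/
theorem exists_gt_forall_notMem_of_isCompact {N : Type*} [TopologicalSpace N] [T2Space N]
    {φ : ℝ → N → N} (hφ : Continuous fun q : ℝ × N ↦ φ q.1 q.2) {K₀ K₁ : Set N}
    (hK₀ : IsCompact K₀) (hK₁ : IsCompact K₁) {ℓ : ℝ}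
    (h : ∀ t, |t| ≤ ℓ → ∀ z ∈ K₀, φ t z ∉ K₁) :
    ∃ T > ℓ, ∀ t, |t| ≤ T → ∀ z ∈ K₀, φ t z ∉ K₁ := by
  let S : Set (ℝ × N) := (Icc (-(ℓ + 1)) (ℓ + 1) ×ˢ K₀) ∩ (fun q ↦ φ q.1 q.2) ⁻¹' K₁
  have hS : IsCompact S := (isCompact_Icc.prod hK₀).inter_right (hK₁.isClosed.preimage hφ)
  rcases S.eq_empty_or_nonempty with hSe | hSn
  · refine ⟨ℓ + 1, by linarith, fun t ht z hz hz1 ↦ ?_⟩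
    have : (t, z) ∈ S := ⟨⟨abs_le.1 ht, hz⟩, hz1⟩
    rw [hSe] at this
    exact this
  · obtain ⟨⟨t₀, z₀⟩, hz₀, hmin⟩ := hS.exists_isMinOn hSn (f := fun q ↦ |q.1|)
      continuous_fst.abs.continuousOn
    have ht₀ : ℓ < |t₀| := lt_of_not_ge fun hle ↦ h t₀ hle z₀ hz₀.1.2 hz₀.2
    refine ⟨min (ℓ + 1) ((ℓ + |t₀|) / 2), lt_min (by linarith) (by linarith),
      fun t ht z hz hz1 ↦ ?_⟩
    obtain ⟨ht1, ht2⟩ := le_min_iff.1 ht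
    have : |t₀| ≤ |t| := hmin (show (t, z) ∈ S from ⟨⟨abs_le.1 ht1, hz⟩, hz1⟩)
    linarith

theorem isCompact_annulus_setOf_abs_le {R : EReal} {ρ : ℝ} (hρ : (ρ : EReal) < R) :
    IsCompact {q : annulus R | |(q : ℝ × Circle).1| ≤ ρ} := by
  rw [Subtype.isCompact_iff]
  have h : ((Subtype.val : annulus R → ℝ × Circle) '' {q : annulus R | |(q : ℝ × Circle).1| ≤ ρ}) =
      Icc (-ρ) ρ ×ˢ univ := by
    ext q
    constructor
    · rintro ⟨q, hq, rfl⟩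
      exact ⟨abs_le.1 hq, mem_univ _⟩
    · intro hq
      have hq1 : |q.1| ≤ ρ := abs_le.2 hq.1
      exact ⟨⟨q, (EReal.coe_le_coe_iff.2 hq1).trans_lt hρ⟩, hq1, rfl⟩
  rw [h]
  exact isCompact_Icc.prod isCompact_univ

variable {E : Type u} [NormedAddCommGroup E] [NormedSpace ℝ E] [FiniteDimensional ℝ E]
  {H : Type*} [TopologicalSpace H] {I : ModelWithCorners ℝ E H}
  {M : Type*} [TopologicalSpace M] [ChartedSpace H M] [T2Space M] [SigmaCompactSpace M]
  [IsManifold I ∞ M]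

/-- A separating function on `M × S¹` whose derivative along the suspension of `G` is bounded by
`b` bounds the invariant of the stabilized sets. The test functions are `U κ(r + G)` and a
compactly supported modification of `r + G`, where `κ` is a cutoff equal to `1` on the range of `G`.
Their supports lie over `|r| ≤ max G - min G + δ` for some small `δ`, so they fit into the
annulus. -/
theorem pb4_stab_le {Ω : BilinField I M} (hΩ : IsSymplecticForm Ω) {X₀ X₁ Y₀ Y₁ : Set M}
    (hY₀ : IsCompact Y₀) (hY₁ : IsCompact Y₁) {R : EReal} {G : M × Circle → ℝ}
    (hG : SmoothCompactlySupported (I.prod (𝓡 1)) G)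
    (hGY₀ : ∀ z, ∀ y ∈ Y₀, G (y, z) ≤ 0) (hGY₁ : ∀ z, ∀ y ∈ Y₁, 1 ≤ G (y, z))
    (hosc : (((⨆ q, G q) - (⨅ q, G q) : ℝ) : EReal) < R)
    {U : M × Circle → ℝ} (hU : ContMDiff (I.prod (𝓡 1)) 𝓘(ℝ, ℝ) ∞ U) (hUc : HasCompactSupport U)
    (hU₀ : ∀ z ∈ X₀ ×ˢ (univ : Set Circle), U z = 0)
    (hU₁ : ∀ z ∈ X₁ ×ˢ (univ : Set Circle), U z = 1) {b : ℝ}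
    (hb : ∀ z, |mvfderiv (I.prod (𝓡 1)) U z (suspensionField Ω G z)| ≤ b) :
    pb4 (Ω.prod (annulusForm R)) (stab R X₀) (stab R X₁) (stab R Y₀) (stab R Y₁) ≤
      ENNReal.ofReal b := by
  obtain ⟨ρ, hρ, hρR⟩ := EReal.lt_iff_exists_real_btwn.1 hosc
  rw [EReal.coe_lt_coe_iff] at hρ
  set m := ⨅ q, G q
  set m' := ⨆ q, G q
  obtain ⟨δ, hδ, hδρ⟩ : ∃ δ > 0, m' - m + δ = ρ := ⟨ρ - (m' - m), by linarith, by ring⟩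
  obtain ⟨B, hB⟩ := hG.1.continuous.bounded_above_of_compact_support hG.2
  have hmG : ∀ q, m ≤ G q :=
    ciInf_le ⟨-B, by rintro _ ⟨q, rfl⟩; exact (abs_le.1 (hB q)).1⟩
  have hGm : ∀ q, G q ≤ m' :=
    le_ciSup ⟨B, by rintro _ ⟨q, rfl⟩; exact (abs_le.1 (hB q)).2⟩
  let s := suspensionHamiltonian (M := M) R G
  have hs : ContMDiff (I.prod cylModel) 𝓘(ℝ, ℝ) ∞ s := contMDiff_suspensionHamiltonian R hG.1
  obtain ⟨κ, hκ, -, hκ1, hκ0, hκ01⟩ := exists_contMDiff_cutoff 𝓘(ℝ, ℝ) (isCompact_Icc (a := m)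
    (b := m')) isOpen_Ioo (Icc_subset_Ioo (a₂ := m - δ / 2) (b₂ := m' + δ / 2)
      (by linarith) (by linarith))
  obtain ⟨ζ, hζ, -, hζ1, hζ0, -⟩ := exists_contMDiff_cutoff 𝓘(ℝ, ℝ)
    (isCompact_Icc (a := m - δ / 2) (b := m' + δ / 2)) isOpen_Ioo
      (Icc_subset_Ioo (a₂ := m - δ) (b₂ := m' + δ) (by linarith) (by linarith))
  let C : Set M := Prod.fst '' tsupport U
  have hC : IsCompact C := IsCompact.image hUc continuous_fst
  obtain ⟨η, hη, hηc, hη1, -, -⟩ := exists_contMDiff_cutoff I ((hC.union hY₀).union hY₁)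
    isOpen_univ (subset_univ _)
  let F : M × annulus R → ℝ := fun q ↦ U (baseProj R q) * κ (s q)
  let K : M × annulus R → ℝ := fun q ↦ η q.1 * (s q * ζ (s q))
  -- A bound on `r + G` bounds `r`, which keeps the supports away from the ends of the annulus.
  have hcpt : ∀ {L : Set M} {f : M × annulus R → ℝ}, IsCompact L →
      (∀ q, f q ≠ 0 → q.1 ∈ L ∧ s q ∈ Ioo (m - δ) (m' + δ)) → HasCompactSupport f := by
    intro L f hL hf
    refine HasCompactSupport.intro (hL.prod (isCompact_annulus_setOf_abs_le hρR)) fun q hq ↦ ?_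
    by_contra hne
    obtain ⟨h1, h2⟩ := hf q hne
    refine hq ⟨h1, ?_⟩
    have h3 : s q = (q.2 : ℝ × Circle).1 + G (baseProj R q) := rfl
    have h4 := hmG (baseProj R q)
    have h5 := hGm (baseProj R q)
    change |(q.2 : ℝ × Circle).1| ≤ ρ
    rw [abs_le]
    constructor <;> linarith [h2.1, h2.2]
  have hF : SmoothCompactlySupported (I.prod cylModel) F := by
    refine ⟨(hU.comp (contMDiff_baseProj R)).mul (hκ.comp hs), hcpt hC fun q hq ↦ ⟨?_, ?_⟩⟩
    · exact ⟨baseProj R q, subset_tsupport _ (left_ne_zero_of_mul hq), rfl⟩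
    · have : s q ∈ Ioo (m - δ / 2) (m' + δ / 2) := by
        by_contra hne
        exact right_ne_zero_of_mul hq (hκ0 _ hne)
      exact ⟨by linarith [this.1], by linarith [this.2]⟩
  have hK : SmoothCompactlySupported (I.prod cylModel) K := by
    refine ⟨(hη.comp contMDiff_fst).mul (hs.mul (hζ.comp hs)), hcpt hηc fun q hq ↦ ⟨?_, ?_⟩⟩
    · exact subset_tsupport _ (left_ne_zero_of_mul hq)
    · by_contra hne
      exact right_ne_zero_of_mul (right_ne_zero_of_mul hq) (hζ0 _ hne)
  -- On the zero section `{r = 0}` the function `r + G` is `G`.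
  have hs0 : ∀ q : M × annulus R, (q.2 : ℝ × Circle).1 = 0 → s q = G (baseProj R q) := by
    intro q hq
    change (q.2 : ℝ × Circle).1 + G (baseProj R q) = _
    rw [hq, zero_add]
  have hK0 : ∀ q : M × annulus R, (q.2 : ℝ × Circle).1 = 0 → q.1 ∈ C ∪ Y₀ ∪ Y₁ →
      K q = G (baseProj R q) := by
    intro q hq hqC
    have h1 : s q ∈ Icc (m - δ / 2) (m' + δ / 2) := by
      rw [hs0 q hq]
      exact ⟨by linarith [hmG (baseProj R q)], by linarith [hGm (baseProj R q)]⟩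
    change η q.1 * (s q * ζ (s q)) = _
    rw [hη1.self_of_nhdsSet _ hqC, hζ1.self_of_nhdsSet _ h1, hs0 q hq, one_mul, mul_one]
  have hmem : (F, K) ∈ classF4 (I.prod cylModel) (stab R X₀) (stab R X₁) (stab R Y₀)
      (stab R Y₁) := by
    refine ⟨hF, hK, fun q hq ↦ ?_, fun q hq ↦ ?_, fun q hq ↦ ?_, fun q hq ↦ ?_⟩
    · change U (baseProj R q) * κ (s q) ≤ 0
      rw [hU₀ _ ⟨hq.1, mem_univ _⟩, zero_mul]
    · change 1 ≤ U (baseProj R q) * κ (s q)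
      rw [hU₁ _ ⟨hq.1, mem_univ _⟩, hs0 q hq.2,
        hκ1.self_of_nhdsSet _ ⟨hmG (baseProj R q), hGm (baseProj R q)⟩, one_mul]
    · exact (hK0 q hq.2 (.inl (.inr hq.1))).le.trans (hGY₀ _ _ hq.1)
    · exact (hGY₁ _ _ hq.1).trans (hK0 q hq.2 (.inr hq.1)).ge
  refine (iInf₂_le (F, K) hmem).trans (iSup_le fun q ↦ ?_)
  rw [Real.enorm_eq_ofReal_abs]
  refine ENNReal.ofReal_le_ofReal ?_
  have hb0 : 0 ≤ b := (abs_nonneg _).trans (hb (baseProj R q))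
  by_cases hq : q ∈ tsupport F
  · have hqs : s q ∈ Icc (m - δ / 2) (m' + δ / 2) := by
      refine closure_minimal (fun q hq ↦ ?_) (isClosed_Icc.preimage hs.continuous) hq
      refine Ioo_subset_Icc_self ?_
      by_contra hne
      exact right_ne_zero_of_mul hq (hκ0 _ hne)
    have hqC : q.1 ∈ C :=
      closure_minimal (fun q hq ↦ (⟨baseProj R q, subset_tsupport _ (left_ne_zero_of_mul hq), rfl⟩ :
        q.1 ∈ C)) (hC.isClosed.preimage continuous_fst) hq
    have hKs : K =ᶠ[𝓝 q] suspensionHamiltonian R G := by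
      have h1 := continuous_fst.continuousAt.eventually
        (eventually_nhdsSet_iff_forall.1 hη1 q.1 (.inl (.inl hqC)))
      have h2 := hs.continuous.continuousAt.eventually
        (eventually_nhdsSet_iff_forall.1 hζ1 (s q) hqs)
      filter_upwards [h1, h2] with y hy1 hy2
      change η y.1 * (s y * ζ (s y)) = s y
      rw [hy1, hy2, one_mul, mul_one]
    have h := poissonBracket_mul_comp_suspensionHamiltonian R hΩ hG.1 hU hκ.contDiff q hKs
    change |poissonBracket (Ω.prod (annulusForm R))
      (fun q ↦ U (baseProj R q) * κ (suspensionHamiltonian R G q)) K q| ≤ b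
    rw [h, abs_mul, abs_of_nonneg (hκ01 _).1]
    exact (mul_le_of_le_one_left (abs_nonneg _) (hκ01 _).2).trans (hb _)
  · have h : poissonBracket (Ω.prod (annulusForm R)) F K q = 0 := by
      rw [poissonBracket, mvfderiv_eq_zero_of_notMem_tsupport hq]
      rfl
    change |poissonBracket (Ω.prod (annulusForm R)) F K q| ≤ b
    rw [h, abs_zero]
    exact hb0

end UpperBound

/-! ### Existence of the chord -/

theorem theorem1p6
    {E : Type*} [NormedAddCommGroup E] [NormedSpace ℝ E] [FiniteDimensional ℝ E]
    {M : Type*} [TopologicalSpace M] [T2Space M] [SecondCountableTopology M]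
    [ChartedSpace E M] [IsManifold 𝓘(ℝ, E) ∞ M]
    (Ω : BilinField 𝓘(ℝ, E) M) (hΩ : IsSymplecticForm Ω)
    (X₀ X₁ Y₀ Y₁ : Set M)
    (hX₀ : IsCompact X₀) (hX₁ : IsCompact X₁) (hY₀ : IsCompact Y₀) (hY₁ : IsCompact Y₁)
    (hX : X₀ ∩ X₁ = ∅) (hY : Y₀ ∩ Y₁ = ∅)
    (R : EReal) (hR : 1 < R)
    (p : ℝ) (hp : 0 < p)
    (hpb : pb4 (Ω.prod (annulusForm R)) (stab R X₀) (stab R X₁) (stab R Y₀) (stab R Y₁)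
      = ENNReal.ofReal p)
    (G : M × Circle → ℝ) (hG : SmoothCompactlySupported (𝓘(ℝ, E).prod (𝓡 1)) G)
    (hGY₀ : ∀ t : ℝ, ∀ y ∈ Y₀, G (y, circlePt t) ≤ 0)
    (hGY₁ : ∀ t : ℝ, ∀ y ∈ Y₁, 1 ≤ G (y, circlePt t))
    (hosc : (((⨆ q, G q) - (⨅ q, G q) : ℝ) : EReal) < R) :
    (∃ g : ℝ → M → M, IsHamiltonianFlow Ω G g) ∧
    ∀ g : ℝ → M → M, IsHamiltonianFlow Ω G g →
      ∃ (x : M) (t₀ t₁ : ℝ), |t₀ - t₁| ≤ 1 / p ∧ g t₀ x ∈ X₀ ∧ g t₁ x ∈ X₁ := by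
  have : LocallyCompactSpace M := Manifold.locallyCompact_of_finiteDimensional 𝓘(ℝ, E)
  have : SigmaCompactSpace M := sigmaCompactSpace_of_locallyCompact_secondCountable
  have : IsManifold (𝓡 1) ∞ Circle := .of_le (n := ω) le_top
  have hv := contMDiff_suspensionField hΩ hG.1
  obtain ⟨φ, hφ⟩ := exists_isGlobalFlow_suspensionField hΩ hG
  refine ⟨⟨_, hφ.isHamiltonianFlow⟩, fun g hg ↦ ?_⟩
  by_contra hno
  have hchord : ∀ t, |t| ≤ 1 / p → ∀ z ∈ X₀ ×ˢ (Set.univ : Set Circle),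
      φ t z ∉ X₁ ×ˢ (Set.univ : Set Circle) := by
    intro t ht z hz hz1
    obtain ⟨x, t₀, hx⟩ := hφ.exists_hamiltonian_orbit hΩ hG.1 hg z
    refine hno ⟨x, t₀ + 0, t₀ + t, ?_, ?_, ?_⟩
    · rwa [add_zero, sub_add_cancel_left, abs_neg]
    · rw [← hx, hφ.zero]
      exact hz.1
    · rw [← hx]
      exact hz1.1
  have hK₀ : IsCompact (X₀ ×ˢ (Set.univ : Set Circle)) := hX₀.prod isCompact_univ
  have hK₁ : IsCompact (X₁ ×ˢ (Set.univ : Set Circle)) := hX₁.prod isCompact_univ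
  obtain ⟨T, hT, hchordT⟩ :=
    exists_gt_forall_notMem_of_isCompact (hφ.continuous_uncurry hv) hK₀ hK₁ hchord
  have hT0 : 0 < T := (one_div_pos.2 hp).trans hT
  obtain ⟨b, hTb, hbp⟩ := exists_between ((one_div_lt hT0 hp).2 hT)
  obtain ⟨U, hU, hUc, hU₀, hU₁, hUb⟩ :=
    hφ.exists_separating_function hv hK₀ hK₁ hT0 hchordT hTb
  have hle := pb4_stab_le hΩ hY₀ hY₁ hG
    (fun z y hy ↦ by
      obtain ⟨t, rfl⟩ := circlePt_surjective z
      exact hGY₀ t y hy)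
    (fun z y hy ↦ by
      obtain ⟨t, rfl⟩ := circlePt_surjective z
      exact hGY₁ t y hy) hosc hU hUc hU₀ hU₁ hUb
  rw [hpb] at hle
  exact absurd hle (not_le.2 ((ENNReal.ofReal_lt_ofReal_iff hp).2 hbp))
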